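/- Let $T, d_u, U_0, V_0 > 0$ and $M \ge \max\{U_0, V_0\}$, and let $F : [0,\infty)^2 \to [0,\infty)$ be (locally) Hölder continuous with some exponent $\alpha>0$, with $F(u,0)=F(0,v)=0$ for all $u,v\ge 0$, $F(u,v)>0$ for $u,v>0$, and $F$ non-decreasing in each variable. Put $u_0^\infty = U_0$, $v_0^\infty = 0$ for $x<0$ and $u_0^\infty = 0$, $v_0^\infty = V_0$ for $x>0$. (Whole line.) For $k>0$ let $u_0^k, v_0^k \in C^2(\mathbb{R})$ satisfy: $0\le u_0^k, v_0^k\le M$; $u_0^k \to U_0, 0$ and $v_0^k\to 0, V_0$ as $x\to -\infty, \infty$ respectively; $u_0^k-u_0^\infty,\ v_0^k-v_0^\infty \in L^1(\mathbb{R})$ depend continuously on $k$ as elements of $L^1(\mathbb{R})$, with a continuous extension to $k=0$, and tend to $0$ in $L^1(\mathbb{R})$ as $k\to\infty$; and $\|u_0^k(\cdot+\xi)-u_0^k\|_{L^1(\mathbb{R})} + \|v_0^k(\cdot+\xi)-v_0^k\|_{L^1(\mathbb{R})} \le \omega(|\xi|)$ for all $k>0$, $\xi\in\mathbb{R}$,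 with a continuous $\omega:[0,\infty)\to[0,\infty)$, $\omega(\mu)\to 0$ as $\mu\to 0$. Then for every $D>0$ there is a constant $C>0$, independent of $k>0$ and of $d_v\in[0,D]$, such that every solution $(u^k,v^k)$ of $$(P_1^k)\quad u_t = d_u u_{xx} - kF(u,v),\quad v_t = d_v v_{xx} - kF(u,v)\ \text{ in } \mathbb{R}\times(0,T),\qquad u(\cdot,0)=u_0^k,\ v(\cdot,0)=v_0^k,$$ with $0\le u^k, v^k\le M$ on $\mathbb{R}\times(0,T)$ satisfies $$\int_0^T\int_{\mathbb{R}} kF(u^k,v^k)\,dx\,dt\le C.$$ (Half-line.) For $k>0$ let $u_0^k, v_0^k\in C^2([0,\infty))$ satisfy: $0\le u_0^k,v_0^k\le M$; $u_0^k\to 0$ and $v_0^k\to V_0$ as $x\to\infty$; $u_0^k - u_0^\infty,\ v_0^k - v_0^\infty\in L^1(0,\infty)$, both tending to $0$ in $L^1(0,\infty)$ as $k\to\infty$; $\sup_{k>0}\|u_0^k\|_{L^1(0,\infty)}<\infty$; and, for each $r>0$, $\|u_0^k(\cdot+\xi)-u_0^k\|_{L^1(r,\infty)} + \|v_0^k(\cdot+\xi)-v_0^k\|_{L^1(r,\infty)}\le\omega_r(|\xi|)$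 for all $k>0$, $|\xi|<r/4$, with a continuous $\omega_r:[0,\infty)\to[0,\infty)$, $\omega_r(\mu)\to0$ as $\mu\to0$. Then for every $D>0$ there is a constant $C>0$, independent of $k>0$ and of $d_v\in[0,D]$, such that every solution $(u^k,v^k)$ of $$(P_2^k)\quad \begin{cases} u_t = d_u u_{xx} - kF(u,v),\quad v_t = d_v v_{xx} - kF(u,v) & \text{in } (0,\infty)\times(0,T),\\ u(0,t)=U_0,\quad d_v v_x(0,t)=0 & \text{for } t\in(0,T),\\ u(\cdot,0)=u_0^k,\quad v(\cdot,0)=v_0^k & \text{on } (0,\infty),\end{cases}$$ with $0\le u^k,v^k\le M$ on $(0,\infty)\times(0,T)$ satisfies $$\int_0^T\int_0^\infty kF(u^k,v^k)\,dx\,dt\le C.$$ Here, if $d_v>0$, a solution is a classical one: $u,v$ are $C^{2,1}$ on $\mathbb{R}\times(0,T]$ (resp. $[0,\infty)\times(0,T]$), continuous on $\mathbb{R}\times[0,T]$ (resp. $(0,\infty)\times[0,T]$), and satisfy the problem pointwise. If $d_v=0$, a solution is a weak one: $u,v\in L^\infty$ of the strip $\Omega\times(0,T)$ ($\Omega=\mathbb{R}$,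 resp. $\Omega=(0,\infty)$), and $$\int_0^T\!\!\int_\Omega u\psi_t\,dx\,dt + \int_0^T\!\!\int_\Omega\{d_u u\psi_{xx} - kF(u,v)\psi\}\,dx\,dt = -\int_\Omega u_0^k\psi(\cdot,0)\,dx - \beta,$$ $$\int_0^T\!\!\int_\Omega v\psi_t\,dx\,dt - \int_0^T\!\!\int_\Omega kF(u,v)\psi\,dx\,dt = -\int_\Omega v_0^k\psi(\cdot,0)\,dx,$$ with $\beta = 0$ (resp. $\beta = d_uU_0\int_0^T\psi_x(0,t)\,dt$), for all $\psi\in C^{2,1}(\overline\Omega\times[0,T])$ with $\psi(\cdot,T)=0$ and support in $\{|x|\le J\}$ for some $J>0$ (resp. also $\psi(0,t)=0$ for $t\in(0,T)$). -/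

import Mathlib

open Set Filter Topology MeasureTheory
open scoped NNReal ENNReal

namespace FastReaction

/-- The space-time strip `{(x,t) : x ∈ Ω, 0 < t < T}` (`Q_T` for `Ω = ℝ`, `S_T` for
`Ω = (0,∞)`). -/
def strip (Ω : Set ℝ) (T : ℝ) : Set (ℝ × ℝ) := Ω ×ˢ Ioo 0 T

/-- The interaction functions `F : [0,∞) × [0,∞) → [0,∞)`: Hölder continuous with some exponent
`α > 0` on bounded sets, zero exactly on the axes and positive elsewhere, non-decreasing in each
variable. Values of `F` off the closed quadrant play no role. -/
structure IsReaction (F : ℝ → ℝ → ℝ) : Prop where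
  holder : ∃ α : ℝ≥0, 0 < α ∧ ∀ R : ℝ, ∃ c : ℝ≥0,
    HolderOnWith c α (fun p : ℝ × ℝ => F p.1 p.2) (Icc 0 R ×ˢ Icc 0 R)
  zero_right : ∀ u, 0 ≤ u → F u 0 = 0
  zero_left : ∀ v, 0 ≤ v → F 0 v = 0
  pos : ∀ u v, 0 < u → 0 < v → 0 < F u v
  mono_left : ∀ v, 0 ≤ v → MonotoneOn (fun u => F u v) (Ici 0)
  mono_right : ∀ u, 0 ≤ u → MonotoneOn (fun v => F u v) (Ici 0)

/-- `u₀^∞`: equal to `U₀` for `x < 0` and to `0` for `x > 0`. -/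
noncomputable def uInf (U₀ : ℝ) (x : ℝ) : ℝ := if x < 0 then U₀ else 0

/-- `v₀^∞`: equal to `0` for `x < 0` and to `V₀` for `x > 0`. -/
noncomputable def vInf (V₀ : ℝ) (x : ℝ) : ℝ := if x < 0 then 0 else V₀

/-- The map `k ↦ f k` (given for `k > 0`) belongs to `C([0,∞), L¹(ℝ))`, its value at `k = 0` being
some element of `L¹(ℝ)`. -/
def ContinuousIntoL1 (f : ℝ → ℝ → ℝ) : Prop :=
  ∃ g : ℝ → (ℝ →₁[volume] ℝ), ContinuousOn g (Ici 0) ∧ ∀ k, 0 < k → g k =ᵐ[volume] f k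

/-- Continuous `ω : [0,∞) → [0,∞)` with `ω(μ) → 0` as `μ → 0`. -/
structure IsModulus (ω : ℝ → ℝ) : Prop where
  continuousOn : ContinuousOn ω (Ici 0)
  nonneg : ∀ μ, 0 ≤ μ → 0 ≤ ω μ
  tendsto : Tendsto ω (𝓝[>] 0) (𝓝 0)

/-- Admissible families `k ↦ (u₀^k, v₀^k)`, `k > 0`, of initial data on the whole line. -/
structure IsLineData (U₀ V₀ M : ℝ) (u₀ v₀ : ℝ → ℝ → ℝ) : Prop where
  smooth_u : ∀ k, 0 < k → ContDiff ℝ 2 (u₀ k)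
  smooth_v : ∀ k, 0 < k → ContDiff ℝ 2 (v₀ k)
  bound_u : ∀ k, 0 < k → ∀ x, 0 ≤ u₀ k x ∧ u₀ k x ≤ M
  bound_v : ∀ k, 0 < k → ∀ x, 0 ≤ v₀ k x ∧ v₀ k x ≤ M
  tendsto_u_bot : ∀ k, 0 < k → Tendsto (u₀ k) atBot (𝓝 U₀)
  tendsto_u_top : ∀ k, 0 < k → Tendsto (u₀ k) atTop (𝓝 0)
  tendsto_v_bot : ∀ k, 0 < k → Tendsto (v₀ k) atBot (𝓝 0)
  tendsto_v_top : ∀ k, 0 < k → Tendsto (v₀ k) atTop (𝓝 V₀)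
  memL1_u : ∀ k, 0 < k → MemLp (fun x => u₀ k x - uInf U₀ x) 1 volume
  memL1_v : ∀ k, 0 < k → MemLp (fun x => v₀ k x - vInf V₀ x) 1 volume
  continuous_u : ContinuousIntoL1 (fun k x => u₀ k x - uInf U₀ x)
  continuous_v : ContinuousIntoL1 (fun k x => v₀ k x - vInf V₀ x)
  limit_u : Tendsto (fun k => eLpNorm (fun x => u₀ k x - uInf U₀ x) 1 volume) atTop (𝓝 0)
  limit_v : Tendsto (fun k => eLpNorm (fun x => v₀ k x - vInf V₀ x) 1 volume) atTop (𝓝 0)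
  translates : ∃ ω : ℝ → ℝ, IsModulus ω ∧ ∀ k, 0 < k → ∀ ξ : ℝ,
    eLpNorm (fun x => u₀ k (x + ξ) - u₀ k x) 1 volume
      + eLpNorm (fun x => v₀ k (x + ξ) - v₀ k x) 1 volume ≤ ENNReal.ofReal (ω |ξ|)

/-- Admissible families `k ↦ (u₀^k, v₀^k)`, `k > 0`, of initial data on the half-line. Only the
values at `x ≥ 0` matter. -/
structure IsHalfLineData (U₀ V₀ M : ℝ) (u₀ v₀ : ℝ → ℝ → ℝ) : Prop where
  smooth_u : ∀ k, 0 < k → ContDiffOn ℝ 2 (u₀ k) (Ici 0)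
  smooth_v : ∀ k, 0 < k → ContDiffOn ℝ 2 (v₀ k) (Ici 0)
  bound_u : ∀ k, 0 < k → ∀ x, 0 ≤ x → 0 ≤ u₀ k x ∧ u₀ k x ≤ M
  bound_v : ∀ k, 0 < k → ∀ x, 0 ≤ x → 0 ≤ v₀ k x ∧ v₀ k x ≤ M
  tendsto_u_top : ∀ k, 0 < k → Tendsto (u₀ k) atTop (𝓝 0)
  tendsto_v_top : ∀ k, 0 < k → Tendsto (v₀ k) atTop (𝓝 V₀)
  memL1_u : ∀ k, 0 < k → MemLp (fun x => u₀ k x - uInf U₀ x) 1 (volume.restrict (Ioi 0))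
  memL1_v : ∀ k, 0 < k → MemLp (fun x => v₀ k x - vInf V₀ x) 1 (volume.restrict (Ioi 0))
  limit_u : Tendsto (fun k => eLpNorm (fun x => u₀ k x - uInf U₀ x) 1 (volume.restrict (Ioi 0)))
    atTop (𝓝 0)
  limit_v : Tendsto (fun k => eLpNorm (fun x => v₀ k x - vInf V₀ x) 1 (volume.restrict (Ioi 0)))
    atTop (𝓝 0)
  /-- The `L¹` norm of `u₀^k` on the half-line is bounded independently of `k`. -/
  bounded_u : ∃ B : ℝ, ∀ k, 0 < k →
    eLpNorm (fun x => u₀ k x - uInf U₀ x) 1 (volume.restrict (Ioi 0)) ≤ ENNReal.ofReal B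
  translates : ∀ r : ℝ, 0 < r → ∃ ω : ℝ → ℝ, IsModulus ω ∧ ∀ k, 0 < k → ∀ ξ : ℝ, |ξ| < r / 4 →
    eLpNorm (fun x => u₀ k (x + ξ) - u₀ k x) 1 (volume.restrict (Ioi r))
      + eLpNorm (fun x => v₀ k (x + ξ) - v₀ k x) 1 (volume.restrict (Ioi r))
      ≤ ENNReal.ofReal (ω |ξ|)

/-- `w` is of class `C^{2,1}` on `I × J` (`x ∈ I`, `t ∈ J`), with `w_x = wx`, `w_xx = wxx`,
`w_t = wt` there; derivatives are one-sided at end points belonging to `I` or `J`. -/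
structure HasC21Derivs (I J : Set ℝ) (w wx wxx wt : ℝ → ℝ → ℝ) : Prop where
  deriv_x : ∀ x ∈ I, ∀ t ∈ J, HasDerivWithinAt (fun y => w y t) (wx x t) I x
  deriv_xx : ∀ x ∈ I, ∀ t ∈ J, HasDerivWithinAt (fun y => wx y t) (wxx x t) I x
  deriv_t : ∀ x ∈ I, ∀ t ∈ J, HasDerivWithinAt (fun s => w x s) (wt x t) J t
  cont : ContinuousOn (fun p : ℝ × ℝ => w p.1 p.2) (I ×ˢ J)
  cont_x : ContinuousOn (fun p : ℝ × ℝ => wx p.1 p.2) (I ×ˢ J)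
  cont_xx : ContinuousOn (fun p : ℝ × ℝ => wxx p.1 p.2) (I ×ˢ J)
  cont_t : ContinuousOn (fun p : ℝ × ℝ => wt p.1 p.2) (I ×ˢ J)

/-- `(u, v)` is a classical solution of the whole-line problem with initial data `(u₀, v₀)`:
`C^{2,1}` on `ℝ × (0,T]`, continuous on `ℝ × [0,T]`, equations and initial conditions pointwise. -/
def IsClassicalLine (F : ℝ → ℝ → ℝ) (T du dv k : ℝ) (u₀ v₀ : ℝ → ℝ) (u v : ℝ → ℝ → ℝ) : Prop :=
  ContinuousOn (fun p : ℝ × ℝ => u p.1 p.2) (univ ×ˢ Icc 0 T) ∧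
  ContinuousOn (fun p : ℝ × ℝ => v p.1 p.2) (univ ×ˢ Icc 0 T) ∧
  (∀ x, u x 0 = u₀ x ∧ v x 0 = v₀ x) ∧
  ∃ ux uxx ut vx vxx vt : ℝ → ℝ → ℝ,
    HasC21Derivs univ (Ioc 0 T) u ux uxx ut ∧ HasC21Derivs univ (Ioc 0 T) v vx vxx vt ∧
    ∀ x, ∀ t ∈ Ioo 0 T,
      ut x t = du * uxx x t - k * F (u x t) (v x t) ∧
      vt x t = dv * vxx x t - k * F (u x t) (v x t)

/-- Test functions: `ψ` is `C^{2,1}` on `I × [0,T]` with the displayed derivatives,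
`ψ(·,T) = 0`, and `ψ` vanishes for `|x| > L` for some `L`. -/
def IsTest (I : Set ℝ) (T : ℝ) (ψ ψx ψxx ψt : ℝ → ℝ → ℝ) : Prop :=
  HasC21Derivs I (Icc 0 T) ψ ψx ψxx ψt ∧ (∀ x ∈ I, ψ x T = 0) ∧
  ∃ L : ℝ, ∀ x ∈ I, L < |x| → ∀ t ∈ Icc 0 T, ψ x t = 0

/-- `(u, v) ∈ L^∞(Q_T)²` is a weak solution of the whole-line problem with `d_v = 0`. -/
def IsWeakLine (F : ℝ → ℝ → ℝ) (T du k : ℝ) (u₀ v₀ : ℝ → ℝ) (u v : ℝ → ℝ → ℝ) : Prop :=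
  MemLp (fun p : ℝ × ℝ => u p.1 p.2) ∞ (volume.restrict (strip univ T)) ∧
  MemLp (fun p : ℝ × ℝ => v p.1 p.2) ∞ (volume.restrict (strip univ T)) ∧
  ∀ ψ ψx ψxx ψt : ℝ → ℝ → ℝ, IsTest univ T ψ ψx ψxx ψt →
    ((∫ p in strip univ T, u p.1 p.2 * ψt p.1 p.2)
      + (∫ p in strip univ T, (du * u p.1 p.2 * ψxx p.1 p.2
          - k * F (u p.1 p.2) (v p.1 p.2) * ψ p.1 p.2))
      = - ∫ x, u₀ x * ψ x 0) ∧
    ((∫ p in strip univ T, v p.1 p.2 * ψt p.1 p.2)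
      - (∫ p in strip univ T, k * F (u p.1 p.2) (v p.1 p.2) * ψ p.1 p.2)
      = - ∫ x, v₀ x * ψ x 0)

/-- Solutions of the whole-line problem: classical if `d_v > 0`, weak if `d_v = 0`. -/
def IsSolutionLine (F : ℝ → ℝ → ℝ) (T du dv k : ℝ) (u₀ v₀ : ℝ → ℝ) (u v : ℝ → ℝ → ℝ) : Prop :=
  (0 < dv ∧ IsClassicalLine F T du dv k u₀ v₀ u v) ∨
  (dv = 0 ∧ IsWeakLine F T du k u₀ v₀ u v)

/-- `(u, v)` is a classical solution of the half-line problem with initial data `(u₀, v₀)` and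
boundary conditions `u(0,t) = U₀`, `d_v v_x(0,t) = 0`: `C^{2,1}` on `[0,∞) × (0,T]` and continuous
up to `t = 0` for `x > 0`. Nothing is asked at the corner `(0,0)`, so that `u₀(0) ≠ U₀` is
allowed. -/
def IsClassicalHalfLine (F : ℝ → ℝ → ℝ) (T du dv k U₀ : ℝ) (u₀ v₀ : ℝ → ℝ) (u v : ℝ → ℝ → ℝ) :
    Prop :=
  ContinuousOn (fun p : ℝ × ℝ => u p.1 p.2) (Ioi 0 ×ˢ Icc 0 T) ∧
  ContinuousOn (fun p : ℝ × ℝ => v p.1 p.2) (Ioi 0 ×ˢ Icc 0 T) ∧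
  (∀ x, 0 < x → u x 0 = u₀ x ∧ v x 0 = v₀ x) ∧
  ∃ ux uxx ut vx vxx vt : ℝ → ℝ → ℝ,
    HasC21Derivs (Ici 0) (Ioc 0 T) u ux uxx ut ∧ HasC21Derivs (Ici 0) (Ioc 0 T) v vx vxx vt ∧
    (∀ t ∈ Ioo 0 T, u 0 t = U₀ ∧ dv * vx 0 t = 0) ∧
    ∀ x, 0 < x → ∀ t ∈ Ioo 0 T,
      ut x t = du * uxx x t - k * F (u x t) (v x t) ∧
      vt x t = dv * vxx x t - k * F (u x t) (v x t)

/-- `(u, v) ∈ L^∞(S_T)²` is a weak solution of the half-line problem with `d_v = 0`; the test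
functions vanish at `x = 0`. -/
def IsWeakHalfLine (F : ℝ → ℝ → ℝ) (T du k U₀ : ℝ) (u₀ v₀ : ℝ → ℝ) (u v : ℝ → ℝ → ℝ) : Prop :=
  MemLp (fun p : ℝ × ℝ => u p.1 p.2) ∞ (volume.restrict (strip (Ioi 0) T)) ∧
  MemLp (fun p : ℝ × ℝ => v p.1 p.2) ∞ (volume.restrict (strip (Ioi 0) T)) ∧
  ∀ ψ ψx ψxx ψt : ℝ → ℝ → ℝ, IsTest (Ici 0) T ψ ψx ψxx ψt → (∀ t ∈ Ioo 0 T, ψ 0 t = 0) →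
    ((∫ p in strip (Ioi 0) T, u p.1 p.2 * ψt p.1 p.2)
      + (∫ p in strip (Ioi 0) T, (du * u p.1 p.2 * ψxx p.1 p.2
          - k * F (u p.1 p.2) (v p.1 p.2) * ψ p.1 p.2))
      = - (∫ x in Ioi 0, u₀ x * ψ x 0) - du * U₀ * ∫ t in Ioo 0 T, ψx 0 t) ∧
    ((∫ p in strip (Ioi 0) T, v p.1 p.2 * ψt p.1 p.2)
      - (∫ p in strip (Ioi 0) T, k * F (u p.1 p.2) (v p.1 p.2) * ψ p.1 p.2)
      = - ∫ x in Ioi 0, v₀ x * ψ x 0)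

/-- Solutions of the half-line problem: classical if `d_v > 0`, weak if `d_v = 0`. -/
def IsSolutionHalfLine (F : ℝ → ℝ → ℝ) (T du dv k U₀ : ℝ) (u₀ v₀ : ℝ → ℝ) (u v : ℝ → ℝ → ℝ) :
    Prop :=
  (0 < dv ∧ IsClassicalHalfLine F T du dv k U₀ u₀ v₀ u v) ∨
  (dv = 0 ∧ IsWeakHalfLine F T du k U₀ u₀ v₀ u v)

/-- `0 ≤ u, v ≤ M` almost everywhere on the strip over `Ω` (for functions continuous on the strip
this is the same as everywhere). -/
def Between (Ω : Set ℝ) (T M : ℝ) (u v : ℝ → ℝ → ℝ) : Prop :=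
  ∀ᵐ p ∂(volume.restrict (strip Ω T)),
    0 ≤ u p.1 p.2 ∧ u p.1 p.2 ≤ M ∧ 0 ≤ v p.1 p.2 ∧ v p.1 p.2 ≤ M

/-- `k F(u,v)` is integrable on the strip over `Ω`, with integral at most `C`. -/
def ReactionBound (Ω : Set ℝ) (F : ℝ → ℝ → ℝ) (T k C : ℝ) (u v : ℝ → ℝ → ℝ) : Prop :=
  IntegrableOn (fun p : ℝ × ℝ => k * F (u p.1 p.2) (v p.1 p.2)) (strip Ω T) volume ∧
  ∫ t in Ioo 0 T, ∫ x in Ω, k * F (u x t) (v x t) ≤ C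

end FastReaction

/-! Each unknown solves a scalar equation `w_t = d w_xx - h` with the same `h = kF(u,v) ≥ 0` and `0
≤ w ≤ M`. Testing with a cut-off `χ(x)`, moving both space derivatives onto `χ` and dropping the
nonnegative terminal term gives `∫∫ h χ ≤ ∫ w₀ χ + d M T ‖χ''‖_{L¹}`, in which `k` survives only
through the initial data (`setLIntegral_le_of_classical`, `setLIntegral_le_of_weak`). The norm of
`χ''` depends on the width of the two ramps, not on the length of the plateau, so the plateau may
exhaust a half-line as long as `w₀` has bounded mass there (`PlateauBound.setLIntegral_Ici_le`,
`PlateauBound.setLIntegral_Iic_le`).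

On the whole line the `u` equation controls `x ≥ 0`, where the limit profile of `u₀` vanishes, and
the `v` equation controls `x ≤ 0`, where that of `v₀` does. Together they cover the strip.

On the half-line the `u` equation controls `x ≥ 3`, away from the Dirichlet boundary, where the flux
of `u` is not controlled. The remaining bounded piece `0 < x ≤ 3` is left to `v`, whose initial mass
there is at most a multiple of `M`. For `d_v > 0` the Neumann condition permits a cut-off equal to
`1` at the boundary; for `d_v = 0` there is no `χ''` term, so arbitrarily steep ramps at `0` cost
nothing (`IsSolutionHalfLine.setLIntegral_near_zero_le`). -/

namespace FastReaction

/-! ### Space cut-offs -/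

/-- `χ` is a `C²` cut-off function with derivatives `χ₁`, `χ₂`, supported in `[a, b]`, equal to `1`
on `[a + ε, b - ε]`, with `‖χ₂‖_{L¹} ≤ K`. -/
structure IsCutoff (a b ε K : ℝ) (χ χ₁ χ₂ : ℝ → ℝ) : Prop where
  deriv : ∀ x, HasDerivAt χ (χ₁ x) x
  deriv₁ : ∀ x, HasDerivAt χ₁ (χ₂ x) x
  cont₂ : Continuous χ₂
  nonneg : ∀ x, 0 ≤ χ x
  le_one : ∀ x, χ x ≤ 1
  eq_zero : ∀ x, x ∉ Ioo a b → χ x = 0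
  eq_one : ∀ x ∈ Icc (a + ε) (b - ε), χ x = 1
  integrable₂ : Integrable χ₂
  integral_le : ∫ x, |χ₂ x| ≤ K

namespace IsCutoff

variable {a b ε K : ℝ} {χ χ₁ χ₂ : ℝ → ℝ}

theorem cont (h : IsCutoff a b ε K χ χ₁ χ₂) : Continuous χ :=
  continuous_iff_continuousAt.2 fun x => (h.deriv x).continuousAt

theorem cont₁ (h : IsCutoff a b ε K χ χ₁ χ₂) : Continuous χ₁ :=
  continuous_iff_continuousAt.2 fun x => (h.deriv₁ x).continuousAt

/-- `0` and `1` are the extreme values of `χ`, hence critical values. This removes boundary terms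
without any further information on `χ₁`. -/
theorem deriv_eq_zero (h : IsCutoff a b ε K χ χ₁ χ₂) {x : ℝ} (hx : χ x = 0) : χ₁ x = 0 := by
  refine IsLocalMin.hasDerivAt_eq_zero (Eventually.of_forall fun y => ?_) (h.deriv x)
  rw [hx]; exact h.nonneg y

theorem deriv_eq_zero' (h : IsCutoff a b ε K χ χ₁ χ₂) {x : ℝ} (hx : χ x = 1) : χ₁ x = 0 := by
  refine IsLocalMax.hasDerivAt_eq_zero (Eventually.of_forall fun y => ?_) (h.deriv x)
  rw [hx]; exact h.le_one y

theorem integrable (h : IsCutoff a b ε K χ χ₁ χ₂) : Integrable χ :=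
  h.cont.integrable_of_hasCompactSupport <|
    HasCompactSupport.intro (isCompact_Icc (a := a) (b := b)) fun x hx =>
      h.eq_zero x fun hx' => hx (Ioo_subset_Icc_self hx')

theorem nonneg_bound (h : IsCutoff a b ε K χ χ₁ χ₂) : 0 ≤ K :=
  (integral_nonneg fun _ => abs_nonneg _).trans h.integral_le

end IsCutoff

theorem smoothTransition_iteratedDeriv_two_eq_zero {x : ℝ} (hx : x ∉ Icc (0 : ℝ) 1) :
    deriv (deriv Real.smoothTransition) x = 0 := by
  have key : ∃ c : ℝ, Real.smoothTransition =ᶠ[𝓝 x] fun _ => c := by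
    rw [mem_Icc, not_and_or, not_le, not_le] at hx
    rcases hx with hx | hx
    · exact ⟨0, (eventually_lt_nhds hx).mono fun y hy =>
        Real.smoothTransition.zero_of_nonpos hy.le⟩
    · exact ⟨1, (eventually_gt_nhds hx).mono fun y hy =>
        Real.smoothTransition.one_of_one_le hy.le⟩
  obtain ⟨c, hc⟩ := key
  rw [hc.deriv.deriv_eq]
  simp

/-- Cut-off functions exist, with second derivative of `L¹` norm of order `1 / ε`. -/
theorem exists_isCutoff : ∃ K : ℝ, 0 ≤ K ∧ ∀ a b ε : ℝ, 0 < ε → a + 2 * ε ≤ b →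
    ∃ χ χ₁ χ₂ : ℝ → ℝ, IsCutoff a b ε (K / ε) χ χ₁ χ₂ := by
  set S := Real.smoothTransition with hS
  have hS2 : ContDiff ℝ 2 S := Real.smoothTransition.contDiff
  have hS1 : ContDiff ℝ 1 (deriv S) := by
    have : ContDiff ℝ (1 + 1) S := by exact_mod_cast hS2
    exact (contDiff_succ_iff_deriv.1 this).2.2
  have hd0 : ∀ x, HasDerivAt S (deriv S x) x := fun x =>
    (hS2.differentiable (by norm_num) x).hasDerivAt
  have hd1 : ∀ x, HasDerivAt (deriv S) (deriv (deriv S) x) x := fun x =>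
    (hS1.differentiable (by norm_num) x).hasDerivAt
  have hc2 : Continuous (deriv (deriv S)) := hS1.continuous_deriv (by norm_num)
  have hi : Integrable (deriv (deriv S)) :=
    hc2.integrable_of_hasCompactSupport <|
      HasCompactSupport.intro (isCompact_Icc (a := (0 : ℝ)) (b := 1)) fun x hx =>
        smoothTransition_iteratedDeriv_two_eq_zero hx
  -- The factor `2` counts the ramps. On each, the second derivative scales like `ε⁻²` over a length
  -- `ε`, which gives `K / ε`.
  refine ⟨2 * ∫ x, |deriv (deriv S) x|, by positivity, fun a b ε hε hab => ?_⟩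
  have hl : ∀ x, HasDerivAt (fun x => (x - a) / ε) (1 / ε) x := fun x =>
    ((hasDerivAt_id x).sub_const a).div_const ε
  have hr : ∀ x, HasDerivAt (fun x => (b - x) / ε) (-1 / ε) x := fun x =>
    ((hasDerivAt_id x).const_sub b).div_const ε
  have hε0 := hε.ne'
  have il : Integrable (fun x => deriv (deriv S) ((x - a) / ε)) :=
    (hi.comp_div hε0).comp_sub_right a
  have ir : Integrable (fun x => deriv (deriv S) ((b - x) / ε)) :=
    (hi.comp_div hε0).comp_sub_left b
  have hone : ∀ x, a + ε ≤ x → S ((x - a) / ε) = 1 := fun x hx =>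
    Real.smoothTransition.one_of_one_le (by rw [le_div_iff₀ hε]; linarith)
  have hone' : ∀ x, x ≤ b - ε → S ((b - x) / ε) = 1 := fun x hx =>
    Real.smoothTransition.one_of_one_le (by rw [le_div_iff₀ hε]; linarith)
  -- Since `a + 2ε ≤ b`, at every point at least one of the two summands equals `1`. The sum minus
  -- `1` is then the other one, which is why it stays in `[0, 1]`.
  refine ⟨fun x => S ((x - a) / ε) + S ((b - x) / ε) - 1,
    fun x => deriv S ((x - a) / ε) * (1 / ε) + deriv S ((b - x) / ε) * (-1 / ε),
    fun x => deriv (deriv S) ((x - a) / ε) * (1 / ε) * (1 / ε)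
      + deriv (deriv S) ((b - x) / ε) * (-1 / ε) * (-1 / ε), ?_⟩
  refine ⟨fun x => ?_, fun x => ?_, ?_, fun x => ?_, fun x => ?_, fun x hx => ?_,
    fun x hx => ?_, ?_, ?_⟩
  · exact (((hd0 _).comp x (hl x)).add ((hd0 _).comp x (hr x))).sub_const 1
  · exact (((hd1 _).comp x (hl x)).mul_const _).add (((hd1 _).comp x (hr x)).mul_const _)
  · fun_prop
  · rcases le_total (a + ε) x with h | h
    · have := hone x h
      have := Real.smoothTransition.nonneg ((b - x) / ε)
      simp only [hS] at *
      linarith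
    · have := hone' x (by linarith)
      have := Real.smoothTransition.nonneg ((x - a) / ε)
      simp only [hS] at *
      linarith
  · have := Real.smoothTransition.le_one ((b - x) / ε)
    have := Real.smoothTransition.le_one ((x - a) / ε)
    simp only [hS] at *
    linarith
  · rw [mem_Ioo, not_and_or, not_lt, not_lt] at hx
    rcases hx with h | h
    · have h1 := hone' x (by linarith)
      have h2 : S ((x - a) / ε) = 0 := Real.smoothTransition.zero_of_nonpos
        (div_nonpos_of_nonpos_of_nonneg (by linarith) hε.le)
      simp only [h1, h2]; norm_num
    · have h1 := hone x (by linarith)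
      have h2 : S ((b - x) / ε) = 0 := Real.smoothTransition.zero_of_nonpos
        (div_nonpos_of_nonpos_of_nonneg (by linarith) hε.le)
      simp only [h1, h2]; norm_num
  · simp only [hone x hx.1, hone' x hx.2]; norm_num
  · exact ((il.mul_const _).mul_const _).add ((ir.mul_const _).mul_const _)
  · calc ∫ x, |deriv (deriv S) ((x - a) / ε) * (1 / ε) * (1 / ε)
          + deriv (deriv S) ((b - x) / ε) * (-1 / ε) * (-1 / ε)|
        ≤ ∫ x, (|deriv (deriv S) ((x - a) / ε)| * (1 / ε * (1 / ε))
          + |deriv (deriv S) ((b - x) / ε)| * (1 / ε * (1 / ε))) := by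
          refine integral_mono_of_nonneg (Eventually.of_forall fun x => abs_nonneg _)
            ((il.abs.mul_const _).add (ir.abs.mul_const _)) (Eventually.of_forall fun x => ?_)
          refine (abs_add_le _ _).trans (le_of_eq ?_)
          simp only [abs_mul, abs_div, abs_neg, abs_one, abs_of_pos hε]
          ring
      _ = _ := by
          rw [integral_add (il.abs.mul_const _) (ir.abs.mul_const _), integral_mul_const,
            integral_mul_const,
            integral_sub_right_eq_self (fun x => |deriv (deriv S) (x / ε)|) a,
            integral_sub_left_eq_self (fun x => |deriv (deriv S) (x / ε)|) volume b,
            Measure.integral_comp_div (fun x => |deriv (deriv S) x|) ε, abs_of_pos hε, smul_eq_mul]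
          field_simp
          ring

/-! ### Classical solutions: integration by parts on rectangles -/

theorem HasC21Derivs.mono {I J I' J' : Set ℝ} {w wx wxx wt : ℝ → ℝ → ℝ}
    (h : HasC21Derivs I J w wx wxx wt) (hI : I' ⊆ I) (hJ : J' ⊆ J) :
    HasC21Derivs I' J' w wx wxx wt where
  deriv_x x hx t ht := (h.deriv_x x (hI hx) t (hJ ht)).mono hI
  deriv_xx x hx t ht := (h.deriv_xx x (hI hx) t (hJ ht)).mono hI
  deriv_t x hx t ht := (h.deriv_t x (hI hx) t (hJ ht)).mono hJ
  cont := h.cont.mono (prod_mono hI hJ)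
  cont_x := h.cont_x.mono (prod_mono hI hJ)
  cont_xx := h.cont_xx.mono (prod_mono hI hJ)
  cont_t := h.cont_t.mono (prod_mono hI hJ)

theorem ContinuousOn.slice_left {w : ℝ → ℝ → ℝ} {I J : Set ℝ}
    (h : ContinuousOn (fun p : ℝ × ℝ => w p.1 p.2) (I ×ˢ J)) {t : ℝ} (ht : t ∈ J) :
    ContinuousOn (fun x => w x t) I :=
  h.comp (f := fun x => (x, t)) (by fun_prop) fun _ hx => ⟨hx, ht⟩

theorem ContinuousOn.slice_right {w : ℝ → ℝ → ℝ} {I J : Set ℝ}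
    (h : ContinuousOn (fun p : ℝ × ℝ => w p.1 p.2) (I ×ˢ J)) {x : ℝ} (hx : x ∈ I) :
    ContinuousOn (fun t => w x t) J :=
  h.comp (f := fun t => (x, t)) (by fun_prop) fun _ ht => ⟨hx, ht⟩

theorem integral_Ioo_eq_sub {f f' : ℝ → ℝ} {a b : ℝ} (hab : a ≤ b)
    (hf : ∀ x ∈ Icc a b, HasDerivWithinAt f (f' x) (Icc a b) x)
    (hf' : ContinuousOn f' (Icc a b)) : ∫ x in Ioo a b, f' x = f b - f a := by
  rw [← integral_Ioc_eq_integral_Ioo, ← intervalIntegral.integral_of_le hab]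
  refine intervalIntegral.integral_eq_sub_of_hasDerivAt_of_le hab
    (fun x hx => (hf x hx).continuousWithinAt)
    (fun x hx => (hf x (Ioo_subset_Icc_self hx)).hasDerivAt (Icc_mem_nhds hx.1 hx.2)) ?_
  exact ContinuousOn.intervalIntegrable (by rwa [uIcc_of_le hab])

section Rectangle

variable {α β ε K d p q : ℝ} {χ χ₁ χ₂ : ℝ → ℝ}

/-- Two integrations by parts against a cut-off function. -/
theorem IsCutoff.integral_mul_deriv_deriv (hχ : IsCutoff α β ε K χ χ₁ χ₂) (hpq : p ≤ q)
    (hq : χ q = 0) (hp : χ₁ p = 0) {f f₁ f₂ : ℝ → ℝ}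
    (hf : ∀ x ∈ Icc p q, HasDerivWithinAt f (f₁ x) (Icc p q) x)
    (hf₁ : ∀ x ∈ Icc p q, HasDerivWithinAt f₁ (f₂ x) (Icc p q) x)
    (hf₂ : ContinuousOn f₂ (Icc p q)) (hbd : d * (f₁ p * χ p) = 0) :
    d * ∫ x in Ioo p q, f₂ x * χ x = d * ∫ x in Ioo p q, f x * χ₂ x := by
  have hfc : ContinuousOn f (Icc p q) := fun x hx => (hf x hx).continuousWithinAt
  have hc := hχ.cont
  have hc2 := hχ.cont₂
  have i1 : IntegrableOn (fun x => f₂ x * χ x) (Ioo p q) :=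
    (ContinuousOn.integrableOn_Icc (hf₂.mul hc.continuousOn)).mono_set Ioo_subset_Icc_self
  have i2 : IntegrableOn (fun x => f x * χ₂ x) (Ioo p q) :=
    (ContinuousOn.integrableOn_Icc (hfc.mul hc2.continuousOn)).mono_set Ioo_subset_Icc_self
  -- Green's formula. At `q` both boundary terms vanish; at `p` only the flux `d f₁ χ` is left, and
  -- `hbd` covers both ways of losing it: `χ p = 0` or a Neumann condition.
  have key := integral_Ioo_eq_sub (f := fun x => f₁ x * χ x - f x * χ₁ x)
    (f' := fun x => f₂ x * χ x - f x * χ₂ x) hpq (fun x hx =>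
      (((hf₁ x hx).mul (hχ.deriv x).hasDerivWithinAt).sub
        ((hf x hx).mul (hχ.deriv₁ x).hasDerivWithinAt)).congr_deriv (by ring)) ((hf₂.mul hc.continuousOn).sub (hfc.mul hc2.continuousOn))
  rw [integral_sub i1 i2, hq, hp, hχ.deriv_eq_zero hq] at key
  linear_combination d * key - hbd

/-- The weak form of `h = d w_xx - w_t` on a rectangle, as an inequality. -/
theorem IsCutoff.setIntegral_rectangle_le (hχ : IsCutoff α β ε K χ χ₁ χ₂) (hpq : p ≤ q)
    (hq : χ q = 0) (hp : χ₁ p = 0) (hd : 0 ≤ d) {a b M : ℝ} (hab : a ≤ b) (hM : 0 ≤ M)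
    {w wx wxx wt : ℝ → ℝ → ℝ} (hw : HasC21Derivs (Icc p q) (Icc a b) w wx wxx wt)
    (hbd : ∀ t ∈ Icc a b, d * (wx p t * χ p) = 0)
    (hw0 : ∀ x ∈ Ioo p q, ∀ t ∈ Icc a b, 0 ≤ w x t) (hwM : ∀ x ∈ Ioo p q, ∀ t ∈ Icc a b, w x t ≤ M) :
    ∫ z in Ioo p q ×ˢ Ioo a b, (d * wxx z.1 z.2 - wt z.1 z.2) * χ z.1
      ≤ (∫ x in Ioo p q, w x a * χ x) + d * M * (b - a) * K := by
  have hc := hχ.cont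
  have hc2 := hχ.cont₂
  have hcf : ContinuousOn (fun z : ℝ × ℝ => χ z.1) (Icc p q ×ˢ Icc a b) := by fun_prop
  have hK : IsCompact (Icc p q ×ˢ Icc a b) := isCompact_Icc.prod isCompact_Icc
  have hsub : Ioo p q ×ˢ Ioo a b ⊆ Icc p q ×ˢ Icc a b :=
    prod_mono Ioo_subset_Icc_self Ioo_subset_Icc_self
  have i1 : IntegrableOn (fun z : ℝ × ℝ => wxx z.1 z.2 * χ z.1) (Ioo p q ×ˢ Ioo a b) :=
    (ContinuousOn.integrableOn_compact hK (hw.cont_xx.mul hcf)).mono_set hsub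
  have i2 : IntegrableOn (fun z : ℝ × ℝ => wt z.1 z.2 * χ z.1) (Ioo p q ×ˢ Ioo a b) :=
    (ContinuousOn.integrableOn_compact hK (hw.cont_t.mul hcf)).mono_set hsub
  have e0 : ∫ z in Ioo p q ×ˢ Ioo a b, (d * wxx z.1 z.2 - wt z.1 z.2) * χ z.1
      = d * (∫ z in Ioo p q ×ˢ Ioo a b, wxx z.1 z.2 * χ z.1)
        - ∫ z in Ioo p q ×ˢ Ioo a b, wt z.1 z.2 * χ z.1 := by
    rw [← integral_const_mul, ← integral_sub (i1.const_mul d) i2]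
    congr 1; ext z; ring
  have e2 : ∫ z in Ioo p q ×ˢ Ioo a b, wt z.1 z.2 * χ z.1
      = ∫ x in Ioo p q, (w x b - w x a) * χ x := by
    rw [Measure.volume_eq_prod] at i2 ⊢
    rw [setIntegral_prod _ i2]
    refine setIntegral_congr_fun measurableSet_Ioo fun x hx => ?_
    have hx' := Ioo_subset_Icc_self hx
    simp only
    rw [integral_mul_const, integral_Ioo_eq_sub (f := fun t => w x t) hab
      (fun t ht => hw.deriv_t x hx' t ht) (ContinuousOn.slice_right hw.cont_t hx')]
  have e1 : d * (∫ z in Ioo p q ×ˢ Ioo a b, wxx z.1 z.2 * χ z.1)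
      = ∫ t in Ioo a b, d * ∫ x in Ioo p q, w x t * χ₂ x := by
    rw [← integral_const_mul]
    rw [IntegrableOn, Measure.volume_eq_prod, ← Measure.prod_restrict] at i1
    rw [Measure.volume_eq_prod, ← Measure.prod_restrict, integral_prod_symm _ (i1.const_mul d)]
    refine setIntegral_congr_fun measurableSet_Ioo fun t ht => ?_
    have ht' := Ioo_subset_Icc_self ht
    simp only
    rw [integral_const_mul]
    exact hχ.integral_mul_deriv_deriv hpq hq hp (fun x hx => hw.deriv_x x hx t ht')
      (fun x hx => hw.deriv_xx x hx t ht') (ContinuousOn.slice_left hw.cont_xx ht') (hbd t ht')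
  have b1 : ∫ t in Ioo a b, d * ∫ x in Ioo p q, w x t * χ₂ x ≤ d * M * (b - a) * K := by
    have : ∀ t ∈ Ioo a b, ‖d * ∫ x in Ioo p q, w x t * χ₂ x‖ ≤ d * (M * K) := by
      intro t ht
      rw [norm_mul, Real.norm_of_nonneg hd]
      refine mul_le_mul_of_nonneg_left ?_ hd
      calc ‖∫ x in Ioo p q, w x t * χ₂ x‖ ≤ ∫ x in Ioo p q, M * |χ₂ x| := by
            refine norm_integral_le_of_norm_le (hχ.integrable₂.abs.const_mul M).integrableOn ?_
            filter_upwards [ae_restrict_mem measurableSet_Ioo] with x hx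
            have h0 := hw0 x hx t (Ioo_subset_Icc_self ht)
            rw [norm_mul, Real.norm_of_nonneg h0, Real.norm_eq_abs]
            exact mul_le_mul_of_nonneg_right (hwM x hx t (Ioo_subset_Icc_self ht)) (abs_nonneg _)
        _ ≤ M * ∫ x, |χ₂ x| := by
            rw [integral_const_mul]
            exact mul_le_mul_of_nonneg_left (setIntegral_le_integral hχ.integrable₂.abs
              (Eventually.of_forall fun x => abs_nonneg _)) hM
        _ ≤ M * K := mul_le_mul_of_nonneg_left hχ.integral_le hM
    have := norm_setIntegral_le_of_norm_le_const (μ := volume) (s := Ioo a b) (by simp) this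
    rw [measureReal_def, Real.volume_Ioo, ENNReal.toReal_ofReal (by linarith)] at this
    refine (le_abs_self _).trans (this.trans (le_of_eq (by ring)))
  have b2 : (∫ x in Ioo p q, w x b * χ x) - ∫ x in Ioo p q, w x a * χ x
      = ∫ x in Ioo p q, (w x b - w x a) * χ x := by
    have hi : ∀ t ∈ Icc a b, IntegrableOn (fun x => w x t * χ x) (Ioo p q) := fun t ht =>
      (ContinuousOn.integrableOn_Icc
        ((ContinuousOn.slice_left hw.cont ht).mul hc.continuousOn)).mono_set Ioo_subset_Icc_self
    rw [← integral_sub (hi b ⟨hab, le_rfl⟩) (hi a ⟨le_rfl, hab⟩)]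
    congr 1; ext x; ring
  -- The terminal term has a favourable sign; discarding it is the reason for an inequality.
  have b3 : 0 ≤ ∫ x in Ioo p q, w x b * χ x := by
    refine setIntegral_nonneg measurableSet_Ioo fun x hx => ?_
    exact mul_nonneg (hw0 x hx b ⟨hab, le_rfl⟩) (hχ.nonneg x)
  rw [e0, e1, e2, ← b2]
  linarith

/-- The bound on `∫∫ h χ` for classical solutions of `w_t = d w_xx - h` that attain their initial
data. -/
theorem IsCutoff.setLIntegral_le_of_classical (hχ : IsCutoff α β ε K χ χ₁ χ₂) (hpq : p ≤ q)
    (hq : χ q = 0) (hp : χ₁ p = 0) (hd : 0 ≤ d) {T M : ℝ} (hT : 0 < T) (hM : 0 ≤ M)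
    {w wx wxx wt h : ℝ → ℝ → ℝ} {w₀ : ℝ → ℝ}
    (hw : HasC21Derivs (Icc p q) (Ioc 0 T) w wx wxx wt)
    (hbd : ∀ t ∈ Ioo 0 T, d * (wx p t * χ p) = 0)
    (hw0 : ∀ x ∈ Ioo p q, ∀ t ∈ Ioo 0 T, 0 ≤ w x t ∧ w x t ≤ M)
    (hini : ∀ x ∈ Ioo p q, Tendsto (w x) (𝓝[>] 0) (𝓝 (w₀ x)))
    (heq : ∀ x ∈ Ioo p q, ∀ t ∈ Ioo 0 T, wt x t = d * wxx x t - h x t)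
    (hh : ∀ x ∈ Ioo p q, ∀ t ∈ Ioo 0 T, 0 ≤ h x t) :
    ∫⁻ z in Ioo p q ×ˢ Ioo 0 T, ENNReal.ofReal (h z.1 z.2 * χ z.1)
      ≤ ENNReal.ofReal ((∫ x in Ioo p q, w₀ x * χ x) + d * M * T * K) := by
  -- The equation holds only for `0 < t < T` and derivatives need not extend to `t = 0`, so the
  -- estimate is made on `[a n, T - a n]`. The shift by `3` keeps `a n ≤ T / 2`.
  set a : ℕ → ℝ := fun n => T / (n + 3) with ha
  have ha0 : ∀ n, 0 < a n := fun n => by simp only [ha]; positivity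
  have haT : ∀ n, a n ≤ T - a n := fun n => by
    have : a n ≤ T / 2 := by
      simp only [ha]
      gcongr
      have : (0 : ℝ) ≤ n := Nat.cast_nonneg n
      linarith
    linarith
  have hsub : ∀ n, Icc (a n) (T - a n) ⊆ Ioo 0 T := fun n t ht =>
    ⟨(ha0 n).trans_le ht.1, ht.2.trans_lt (by linarith [ha0 n])⟩
  have hlim : Tendsto a atTop (𝓝 0) := by
    have : Tendsto (fun n : ℕ => T / ((n : ℝ) + 3)) atTop (𝓝 0) :=
      Tendsto.div_atTop tendsto_const_nhds
        (tendsto_atTop_add_const_right _ _ tendsto_natCast_atTop_atTop)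
    exact this
  have hlim' : Tendsto a atTop (𝓝[>] 0) :=
    tendsto_nhdsWithin_iff.2 ⟨hlim, Eventually.of_forall ha0⟩
  have hstep : ∀ n, ∫⁻ z in Ioo p q ×ˢ Ioo (a n) (T - a n), ENNReal.ofReal (h z.1 z.2 * χ z.1)
      ≤ ENNReal.ofReal ((∫ x in Ioo p q, w (x) (a n) * χ x) + d * M * T * K) := by
    intro n
    have hwn : HasC21Derivs (Icc p q) (Icc (a n) (T - a n)) w wx wxx wt :=
      hw.mono le_rfl ((hsub n).trans Ioo_subset_Ioc_self)
    have hmeas : MeasurableSet (Ioo p q ×ˢ Ioo (a n) (T - a n)) :=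
      measurableSet_Ioo.prod measurableSet_Ioo
    have hcongr : ∀ z ∈ Ioo p q ×ˢ Ioo (a n) (T - a n), h z.1 z.2 * χ z.1
        = (d * wxx z.1 z.2 - wt z.1 z.2) * χ z.1 := fun z hz => by
      rw [heq z.1 hz.1 z.2 (hsub n (Ioo_subset_Icc_self hz.2))]; ring
    rw [setLIntegral_congr_fun (g := fun z => ENNReal.ofReal
      ((d * wxx z.1 z.2 - wt z.1 z.2) * χ z.1)) hmeas fun z hz => by simp only [hcongr z hz]]
    have hcf : ContinuousOn (fun z : ℝ × ℝ => χ z.1) (Icc p q ×ˢ Icc (a n) (T - a n)) := by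
      have := hχ.cont
      fun_prop
    rw [← ofReal_integral_eq_lintegral_ofReal]
    · refine ENNReal.ofReal_le_ofReal
        ((hχ.setIntegral_rectangle_le hpq hq hp hd (haT n) hM hwn
          (fun t ht => hbd t (hsub n ht)) (fun x hx t ht => (hw0 x hx t (hsub n ht)).1)
          (fun x hx t ht => (hw0 x hx t (hsub n ht)).2)).trans ?_)
      have hK := hχ.nonneg_bound
      have : T - a n - a n ≤ T := by linarith [ha0 n]
      gcongr
    · exact (ContinuousOn.integrableOn_compact (isCompact_Icc.prod isCompact_Icc)
        (((continuousOn_const.mul hwn.cont_xx).sub hwn.cont_t).mul hcf)).mono_set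
          (prod_mono Ioo_subset_Icc_self Ioo_subset_Icc_self)
    · filter_upwards [ae_restrict_mem hmeas] with z hz
      rw [← hcongr z hz]
      exact mul_nonneg (hh _ hz.1 _ (hsub n (Ioo_subset_Icc_self hz.2))) (hχ.nonneg _)
  have hrhs : Tendsto (fun n => ENNReal.ofReal ((∫ x in Ioo p q, w x (a n) * χ x) + d * M * T * K))
      atTop (𝓝 (ENNReal.ofReal ((∫ x in Ioo p q, w₀ x * χ x) + d * M * T * K))) := by
    refine ENNReal.tendsto_ofReal (Tendsto.add_const _ ?_)
    refine tendsto_integral_of_dominated_convergence (fun x => M * χ x) (fun n => ?_)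
      (hχ.integrable.const_mul M).integrableOn (fun n => ?_) ?_
    · have hcw := ContinuousOn.slice_left hw.cont
        (Ioo_subset_Ioc_self (hsub n (left_mem_Icc.2 (haT n))))
      exact ((hcw.mul hχ.cont.continuousOn).mono Ioo_subset_Icc_self).aestronglyMeasurable
        measurableSet_Ioo
    · filter_upwards [ae_restrict_mem measurableSet_Ioo] with x hx
      have := hw0 x hx (a n) (hsub n (left_mem_Icc.2 (haT n)))
      rw [norm_mul, Real.norm_of_nonneg this.1, Real.norm_of_nonneg (hχ.nonneg x)]
      exact mul_le_mul_of_nonneg_right this.2 (hχ.nonneg x)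
    · filter_upwards [ae_restrict_mem measurableSet_Ioo] with x hx
      exact ((hini x hx).comp hlim').mul_const _
  have hmono : Monotone fun n => Ioo p q ×ˢ Ioo (a n) (T - a n) := by
    intro n m hnm
    have : a m ≤ a n := by
      simp only [ha]
      have : (n : ℝ) ≤ m := Nat.cast_le.2 hnm
      gcongr
    exact prod_mono le_rfl (Ioo_subset_Ioo this (by linarith))
  have hunion : Ioo p q ×ˢ Ioo 0 T = ⋃ n, Ioo p q ×ˢ Ioo (a n) (T - a n) := by
    refine Subset.antisymm (fun z hz => ?_) (iUnion_subset fun n =>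
      prod_mono le_rfl (Ioo_subset_Icc_self.trans (hsub n)))
    obtain ⟨n, hn1, hn2⟩ := ((hlim.eventually_lt_const hz.2.1).and
      (hlim.eventually_lt_const (sub_pos.2 hz.2.2))).exists
    exact mem_iUnion.2 ⟨n, hz.1, hn1, by linarith⟩
  rw [hunion, setLIntegral_iUnion_of_directed _ hmono.directed_le]
  -- The bound on the `m`-th rectangle involves `w(·, a m)`. A fixed rectangle `n` lies in all later
  -- ones, so `m → ∞` replaces this slice by `w₀`.
  refine iSup_le fun n => ge_of_tendsto hrhs ?_
  filter_upwards [eventually_ge_atTop n] with m hm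
  exact (lintegral_mono_set (hmono hm)).trans (hstep m)

end Rectangle

/-! ### Weak solutions: product test functions -/

/-- Decreasing time cut-offs that vanish at `T` and tend to `1` on `[0, T)`. -/
noncomputable def timeCutoff (T : ℝ) (n : ℕ) (t : ℝ) : ℝ := 1 - (t / T) ^ (n + 1)

/-- The derivative of `timeCutoff`. -/
noncomputable def timeCutoffDeriv (T : ℝ) (n : ℕ) (t : ℝ) : ℝ :=
  -((n + 1 : ℕ) * (t / T) ^ n * (1 / T))

theorem hasDerivAt_timeCutoff (T : ℝ) (n : ℕ) (t : ℝ) :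
    HasDerivAt (timeCutoff T n) (timeCutoffDeriv T n t) t :=
  (((hasDerivAt_id t).div_const T).pow (n + 1)).const_sub 1

@[fun_prop]
theorem continuous_timeCutoff (T : ℝ) (n : ℕ) : Continuous (timeCutoff T n) := by
  unfold timeCutoff; fun_prop

@[fun_prop]
theorem continuous_timeCutoffDeriv (T : ℝ) (n : ℕ) : Continuous (timeCutoffDeriv T n) := by
  unfold timeCutoffDeriv; fun_prop

theorem timeCutoff_mem {T t : ℝ} (ht : t ∈ Ioo 0 T) (n : ℕ) : timeCutoff T n t ∈ Icc (0 : ℝ) 1 := by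
  have hT : 0 < T := ht.1.trans ht.2
  have h0 : 0 ≤ t / T := div_nonneg ht.1.le hT.le
  have h1 : t / T ≤ 1 := (div_le_one hT).2 ht.2.le
  have := pow_le_one₀ h0 h1 (n := n + 1)
  have := pow_nonneg h0 (n + 1)
  unfold timeCutoff
  constructor <;> linarith

theorem timeCutoffDeriv_nonpos {T t : ℝ} (ht : t ∈ Ioo 0 T) (n : ℕ) :
    timeCutoffDeriv T n t ≤ 0 := by
  have hT : 0 < T := ht.1.trans ht.2
  have h0 : 0 ≤ t / T := div_nonneg ht.1.le hT.le
  unfold timeCutoffDeriv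
  rw [neg_nonpos]
  positivity

theorem tendsto_timeCutoff {T t : ℝ} (ht : t ∈ Ioo 0 T) :
    Tendsto (fun n => timeCutoff T n t) atTop (𝓝 1) := by
  have hT : 0 < T := ht.1.trans ht.2
  have h0 : 0 ≤ t / T := div_nonneg ht.1.le hT.le
  have h1 : t / T < 1 := (div_lt_one hT).2 ht.2
  have := ((tendsto_pow_atTop_nhds_zero_of_lt_one h0 h1).comp (tendsto_add_atTop_nat 1)).const_sub 1
  simpa [timeCutoff, Function.comp_def] using this

section

variable {a b ε K : ℝ} {χ χ₁ χ₂ : ℝ → ℝ}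

theorem IsCutoff.isTest (hχ : IsCutoff a b ε K χ χ₁ χ₂) (I : Set ℝ) {T : ℝ} (hT : 0 < T) (n : ℕ) :
    IsTest I T (fun x t => χ x * timeCutoff T n t) (fun x t => χ₁ x * timeCutoff T n t)
      (fun x t => χ₂ x * timeCutoff T n t) (fun x t => χ x * timeCutoffDeriv T n t) := by
  have h0 := hχ.cont
  have h1 := hχ.cont₁
  have h2 := hχ.cont₂
  refine ⟨⟨fun x _ t _ => ((hχ.deriv x).mul_const _).hasDerivWithinAt,
    fun x _ t _ => ((hχ.deriv₁ x).mul_const _).hasDerivWithinAt,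
    fun x _ t _ => ((hasDerivAt_timeCutoff T n t).const_mul _).hasDerivWithinAt,
    by fun_prop, by fun_prop, by fun_prop, by fun_prop⟩, fun x _ => ?_, max |a| |b|,
    fun x _ hx t _ => ?_⟩
  · simp [timeCutoff, hT.ne']
  · simp only [hχ.eq_zero x fun hx' => (abs_le_max_abs_abs hx'.1.le hx'.2.le).not_gt hx, zero_mul]

theorem integrableOn_strip_comp_fst {f : ℝ → ℝ} (hf : Integrable f) (Ω : Set ℝ) (T : ℝ) :
    IntegrableOn (fun z : ℝ × ℝ => f z.1) (strip Ω T) := by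
  rw [IntegrableOn, strip, Measure.volume_eq_prod, ← Measure.prod_restrict]
  exact hf.restrict.comp_fst _

theorem setIntegral_strip_comp_fst (f : ℝ → ℝ) (Ω : Set ℝ) {T : ℝ} (hT : 0 < T) :
    ∫ z in strip Ω T, f z.1 = T * ∫ x in Ω, f x := by
  rw [strip, Measure.volume_eq_prod, ← Measure.prod_restrict, integral_fun_fst]
  simp [measureReal_def, hT.le]

/-- The bound on `∫∫ h χ` for weak solutions of `w_t = d w_xx - h`. -/
theorem IsCutoff.setLIntegral_le_of_weak (hχ : IsCutoff a b ε K χ χ₁ χ₂) {Ω : Set ℝ}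
    (hΩ : MeasurableSet Ω) {d T M H : ℝ} (hd : 0 ≤ d) (hT : 0 < T) (hM : 0 ≤ M)
    {w h : ℝ × ℝ → ℝ} {w₀ : ℝ → ℝ}
    (hwm : AEStronglyMeasurable w (volume.restrict (strip Ω T)))
    (hhm : AEStronglyMeasurable h (volume.restrict (strip Ω T)))
    (hw : ∀ᵐ z ∂volume.restrict (strip Ω T), 0 ≤ w z ∧ w z ≤ M)
    (hh : ∀ᵐ z ∂volume.restrict (strip Ω T), 0 ≤ h z ∧ h z ≤ H)
    (hid : ∀ n, (∫ z in strip Ω T, w z * (χ z.1 * timeCutoffDeriv T n z.2))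
      + (∫ z in strip Ω T, (d * w z * (χ₂ z.1 * timeCutoff T n z.2)
        - h z * (χ z.1 * timeCutoff T n z.2)))
      = - ∫ x in Ω, w₀ x * (χ x * timeCutoff T n 0)) :
    ∫⁻ z in strip Ω T, ENNReal.ofReal (h z * χ z.1)
      ≤ ENNReal.ofReal ((∫ x in Ω, w₀ x * χ x) + d * M * T * K) := by
  have hst : MeasurableSet (strip Ω T) := hΩ.prod measurableSet_Ioo
  have hmem : ∀ᵐ z ∂volume.restrict (strip Ω T), z.2 ∈ Ioo 0 T := by
    filter_upwards [ae_restrict_mem hst] with z hz using hz.2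
  have hc := hχ.cont
  have hc2 := hχ.cont₂
  have hK := hχ.nonneg_bound
  have mθ : ∀ n {f : ℝ → ℝ}, Continuous f → AEStronglyMeasurable
      (fun z : ℝ × ℝ => f z.1 * timeCutoff T n z.2) (volume.restrict (strip Ω T)) :=
    fun n f hf => Continuous.aestronglyMeasurable (by fun_prop)
  have i1 : ∀ n, IntegrableOn (fun z => d * w z * (χ₂ z.1 * timeCutoff T n z.2)) (strip Ω T) := by
    intro n
    refine Integrable.mono' ((integrableOn_strip_comp_fst hχ.integrable₂.abs Ω T).const_mul (d * M))
      ((hwm.const_mul d).mul (mθ n hc2)) ?_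
    filter_upwards [hw, hmem] with z hz ht
    have hθ := timeCutoff_mem ht n
    rw [norm_mul, norm_mul, norm_mul, Real.norm_of_nonneg hd, Real.norm_of_nonneg hz.1,
      Real.norm_of_nonneg hθ.1, Real.norm_eq_abs]
    gcongr
    · exact mul_nonneg (abs_nonneg _) hθ.1
    · exact hz.2
    · exact mul_le_of_le_one_right (abs_nonneg _) hθ.2
  have i2 : ∀ n, IntegrableOn (fun z => h z * (χ z.1 * timeCutoff T n z.2)) (strip Ω T) := by
    intro n
    refine Integrable.mono' ((integrableOn_strip_comp_fst hχ.integrable Ω T).const_mul H)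
      (hhm.mul (mθ n hc)) ?_
    filter_upwards [hh, hmem] with z hz ht
    have hθ := timeCutoff_mem ht n
    have h0 := hχ.nonneg z.1
    rw [norm_mul, norm_mul, Real.norm_of_nonneg hz.1, Real.norm_of_nonneg hθ.1,
      Real.norm_of_nonneg h0]
    have hH := hz.1.trans hz.2
    gcongr
    · exact mul_nonneg h0 hθ.1
    · exact hz.2
    · exact mul_le_of_le_one_right h0 hθ.2
  have hstep : ∀ n, ∫⁻ z in strip Ω T, ENNReal.ofReal (h z * (χ z.1 * timeCutoff T n z.2))
      ≤ ENNReal.ofReal ((∫ x in Ω, w₀ x * χ x) + d * M * T * K) := by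
    intro n
    rw [← ofReal_integral_eq_lintegral_ofReal (i2 n)]
    · refine ENNReal.ofReal_le_ofReal ?_
      have e := hid n
      rw [integral_sub (i1 n) (i2 n)] at e
      -- Monotonicity of the time cut-off plays the role of the discarded terminal term.
      have b1 : ∫ z in strip Ω T, w z * (χ z.1 * timeCutoffDeriv T n z.2) ≤ 0 := by
        refine integral_nonpos_of_ae ?_
        filter_upwards [hw, hmem] with z hz ht
        exact mul_nonpos_of_nonneg_of_nonpos hz.1
          (mul_nonpos_of_nonneg_of_nonpos (hχ.nonneg _) (timeCutoffDeriv_nonpos ht n))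
      have b2 : ∫ z in strip Ω T, d * w z * (χ₂ z.1 * timeCutoff T n z.2) ≤ d * M * T * K := by
        calc ∫ z in strip Ω T, d * w z * (χ₂ z.1 * timeCutoff T n z.2)
            ≤ ∫ z in strip Ω T, d * M * |χ₂ z.1| := by
              refine integral_mono_ae (i1 n)
                ((integrableOn_strip_comp_fst hχ.integrable₂.abs Ω T).const_mul (d * M)) ?_
              filter_upwards [hw, hmem] with z hz ht
              have hθ := timeCutoff_mem ht n
              have h1 : χ₂ z.1 * timeCutoff T n z.2 ≤ |χ₂ z.1| :=
                (mul_le_mul_of_nonneg_right (le_abs_self _) hθ.1).trans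
                  (mul_le_of_le_one_right (abs_nonneg _) hθ.2)
              exact (mul_le_mul_of_nonneg_left h1 (mul_nonneg hd hz.1)).trans
                (mul_le_mul_of_nonneg_right (mul_le_mul_of_nonneg_left hz.2 hd) (abs_nonneg _))
          _ = d * M * T * ∫ x in Ω, |χ₂ x| := by
              rw [integral_const_mul, setIntegral_strip_comp_fst (fun x => |χ₂ x|) Ω hT]; ring
          _ ≤ d * M * T * K := by
              have := (setIntegral_le_integral (s := Ω) hχ.integrable₂.abs
                (Eventually.of_forall fun x => abs_nonneg _)).trans hχ.integral_le
              gcongr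
      have e0 : timeCutoff T n 0 = 1 := by simp [timeCutoff]
      simp only [e0, mul_one] at e
      linarith
    · filter_upwards [hh, hmem] with z hz ht
      exact mul_nonneg hz.1 (mul_nonneg (hχ.nonneg _) (timeCutoff_mem ht n).1)
  -- Fatou's lemma removes the time cut-off, as the bound in `hstep` does not depend on `n`.
  calc ∫⁻ z in strip Ω T, ENNReal.ofReal (h z * χ z.1)
      = ∫⁻ z in strip Ω T, liminf (fun n => ENNReal.ofReal
          (h z * (χ z.1 * timeCutoff T n z.2))) atTop := by
        refine lintegral_congr_ae ?_
        filter_upwards [hmem] with z ht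
        refine (Tendsto.liminf_eq (ENNReal.tendsto_ofReal ?_)).symm
        simpa using ((tendsto_timeCutoff ht).const_mul (χ z.1)).const_mul (h z)
    _ ≤ liminf (fun n => ∫⁻ z in strip Ω T, ENNReal.ofReal
          (h z * (χ z.1 * timeCutoff T n z.2))) atTop :=
        lintegral_liminf_le' fun n => (i2 n).1.aemeasurable.ennreal_ofReal
    _ ≤ _ := liminf_le_of_le (by isBoundedDefault) fun c hc =>
        (hc.exists.choose_spec).trans (hstep _)

end

/-! ### Measurability and bounds of the reaction term -/

section Reaction

variable {F : ℝ → ℝ → ℝ}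

theorem IsReaction.nonneg (hF : IsReaction F) {u v : ℝ} (hu : 0 ≤ u) (hv : 0 ≤ v) : 0 ≤ F u v := by
  rw [← hF.zero_left v hv]
  exact hF.mono_left v hv (mem_Ici.2 le_rfl) hu hu

theorem IsReaction.le (hF : IsReaction F) {u v M : ℝ} (hu : 0 ≤ u) (hv : 0 ≤ v) (huM : u ≤ M)
    (hvM : v ≤ M) : F u v ≤ F M M :=
  (hF.mono_left v hv hu (hu.trans huM) huM).trans
    (hF.mono_right M (hu.trans huM) hv (hv.trans hvM) hvM)

theorem IsReaction.continuousOn (hF : IsReaction F) (M : ℝ) :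
    ContinuousOn (fun p : ℝ × ℝ => F p.1 p.2) (Icc 0 M ×ˢ Icc 0 M) := by
  obtain ⟨α, hα, h⟩ := hF.holder
  obtain ⟨c, hc⟩ := h M
  exact hc.continuousOn hα

theorem IsReaction.aestronglyMeasurable (hF : IsReaction F) {Ω : Set ℝ} {T M : ℝ} (hM : 0 ≤ M)
    (k : ℝ) {u v : ℝ → ℝ → ℝ}
    (hu : AEStronglyMeasurable (fun p : ℝ × ℝ => u p.1 p.2) (volume.restrict (strip Ω T)))
    (hv : AEStronglyMeasurable (fun p : ℝ × ℝ => v p.1 p.2) (volume.restrict (strip Ω T)))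
    (hB : Between Ω T M u v) :
    AEStronglyMeasurable (fun p : ℝ × ℝ => k * F (u p.1 p.2) (v p.1 p.2))
      (volume.restrict (strip Ω T)) := by
  -- `F` is arbitrary off the quadrant. Clamping its arguments to `[0, M]` makes it continuous on
  -- the plane and changes the composition only on a null set.
  have hcont : Continuous fun p : ℝ × ℝ => F (projIcc 0 M hM p.1) (projIcc 0 M hM p.2) :=
    (hF.continuousOn M).comp_continuous (f := fun p : ℝ × ℝ =>
      ((projIcc 0 M hM p.1 : ℝ), (projIcc 0 M hM p.2 : ℝ)))
      (by fun_prop) fun p => ⟨Subtype.mem _, Subtype.mem _⟩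
  refine AEStronglyMeasurable.const_mul ?_ k
  refine (hcont.comp_aestronglyMeasurable (hu.prodMk hv)).congr ?_
  filter_upwards [hB] with p hp
  simp only [projIcc_of_mem hM (show u p.1 p.2 ∈ Icc 0 M from ⟨hp.1, hp.2.1⟩),
    projIcc_of_mem hM (show v p.1 p.2 ∈ Icc 0 M from ⟨hp.2.2.1, hp.2.2.2⟩)]

theorem IsReaction.ae_bounds (hF : IsReaction F) {Ω : Set ℝ} {T M k : ℝ} (hk : 0 ≤ k)
    {u v : ℝ → ℝ → ℝ} (hB : Between Ω T M u v) :
    ∀ᵐ p ∂volume.restrict (strip Ω T), 0 ≤ k * F (u p.1 p.2) (v p.1 p.2) ∧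
      k * F (u p.1 p.2) (v p.1 p.2) ≤ k * F M M := by
  filter_upwards [hB] with p hp
  exact ⟨mul_nonneg hk (hF.nonneg hp.1 hp.2.2.1),
    mul_le_mul_of_nonneg_left (hF.le hp.1 hp.2.2.1 hp.2.1 hp.2.2.2) hk⟩

/-- Lower integrals need no integrability in advance, so all estimates are made with them; a finite
bound then yields integrability, and Fubini's theorem the iterated integral. -/
theorem reactionBound_of_setLIntegral_le {Ω : Set ℝ} {T k C : ℝ} {u v : ℝ → ℝ → ℝ}
    (hm : AEStronglyMeasurable (fun p : ℝ × ℝ => k * F (u p.1 p.2) (v p.1 p.2))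
      (volume.restrict (strip Ω T)))
    (h0 : ∀ᵐ p ∂volume.restrict (strip Ω T), 0 ≤ k * F (u p.1 p.2) (v p.1 p.2)) (hC : 0 ≤ C)
    (h : ∫⁻ p in strip Ω T, ENNReal.ofReal (k * F (u p.1 p.2) (v p.1 p.2)) ≤ ENNReal.ofReal C) :
    ReactionBound Ω F T k C u v := by
  have hint : IntegrableOn (fun p : ℝ × ℝ => k * F (u p.1 p.2) (v p.1 p.2)) (strip Ω T) :=
    ⟨hm, (hasFiniteIntegral_iff_ofReal h0).2 (h.trans_lt ENNReal.ofReal_lt_top)⟩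
  refine ⟨hint, ?_⟩
  have e : ∫ t in Ioo 0 T, ∫ x in Ω, k * F (u x t) (v x t)
      = ∫ p in strip Ω T, k * F (u p.1 p.2) (v p.1 p.2) := by
    rw [IntegrableOn, strip, Measure.volume_eq_prod, ← Measure.prod_restrict] at hint
    rw [strip, Measure.volume_eq_prod, ← Measure.prod_restrict, integral_prod_symm _ hint]
  rw [e, integral_eq_lintegral_of_nonneg_ae h0 hm]
  exact ENNReal.toReal_le_of_le_ofReal hC h

end Reaction

/-- `min g 0` is continuous and vanishes almost everywhere on an open set, hence everywhere on it.
Classical solutions thereby obey their bounds on every time slice. -/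
theorem nonneg_of_ae_nonneg_of_continuousOn {U : Set (ℝ × ℝ)} (hU : IsOpen U) {g : ℝ × ℝ → ℝ}
    (hg : ContinuousOn g U) (h : ∀ᵐ p ∂volume.restrict U, 0 ≤ g p) : ∀ p ∈ U, 0 ≤ g p := by
  intro p hp
  have := Measure.eqOn_open_of_ae_eq (μ := volume) (f := fun p => min (g p) 0) (g := fun _ => 0)
    (h.mono fun p hp => min_eq_right hp) hU (hg.inf continuousOn_const) continuousOn_const hp
  exact min_eq_right_iff.1 this

theorem Between.forall {Ω : Set ℝ} (hΩ : IsOpen Ω) {T M : ℝ} {u v : ℝ → ℝ → ℝ}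
    (hu : ContinuousOn (fun p : ℝ × ℝ => u p.1 p.2) (Ω ×ˢ Icc 0 T))
    (hv : ContinuousOn (fun p : ℝ × ℝ => v p.1 p.2) (Ω ×ˢ Icc 0 T))
    (hB : Between Ω T M u v) : ∀ x ∈ Ω, ∀ t ∈ Ioo 0 T,
      (0 ≤ u x t ∧ u x t ≤ M) ∧ 0 ≤ v x t ∧ v x t ≤ M := by
  have hU : IsOpen (strip Ω T) := hΩ.prod isOpen_Ioo
  have hs : strip Ω T ⊆ Ω ×ˢ Icc 0 T := prod_mono le_rfl Ioo_subset_Icc_self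
  replace hu := hu.mono hs
  replace hv := hv.mono hs
  have h1 := nonneg_of_ae_nonneg_of_continuousOn hU hu (hB.mono fun p hp => hp.1)
  have h2 := nonneg_of_ae_nonneg_of_continuousOn hU (continuousOn_const.sub hu)
    (hB.mono fun p hp => sub_nonneg.2 hp.2.1)
  have h3 := nonneg_of_ae_nonneg_of_continuousOn hU hv (hB.mono fun p hp => hp.2.2.1)
  have h4 := nonneg_of_ae_nonneg_of_continuousOn hU (continuousOn_const.sub hv)
    (hB.mono fun p hp => sub_nonneg.2 hp.2.2.2)
  intro x hx t ht
  have hp : (x, t) ∈ strip Ω T := ⟨hx, ht⟩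
  exact ⟨⟨h1 _ hp, sub_nonneg.1 (h2 _ hp)⟩, h3 _ hp, sub_nonneg.1 (h4 _ hp)⟩

/-! ### The plateau estimate, common to classical and weak solutions -/

/-- `h` is bounded in `L¹` on the plateau of every cut-off function supported in `Ω`, in terms of
the data `w₀` and the second derivative of the cut-off, as for a solution of `w_t = d w_xx - h`. -/
def PlateauBound (Ω : Set ℝ) (T M d : ℝ) (w₀ : ℝ → ℝ) (h : ℝ × ℝ → ℝ) : Prop :=
  ∀ ⦃a b ε K : ℝ⦄ ⦃χ χ₁ χ₂ : ℝ → ℝ⦄, IsCutoff a b ε K χ χ₁ χ₂ → 0 < ε → a ≤ b → Icc a b ⊆ Ω →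
    ∫⁻ z in Icc (a + ε) (b - ε) ×ˢ Ioo 0 T, ENNReal.ofReal (h z)
      ≤ ENNReal.ofReal ((∫ x in Ω, w₀ x * χ x) + d * M * T * K)

theorem setLIntegral_le_of_eq_one {s t : Set (ℝ × ℝ)} (hst : s ⊆ t) (hs : MeasurableSet s)
    {h : ℝ × ℝ → ℝ} {χ : ℝ → ℝ} (hχ : ∀ z ∈ s, χ z.1 = 1) :
    ∫⁻ z in s, ENNReal.ofReal (h z) ≤ ∫⁻ z in t, ENNReal.ofReal (h z * χ z.1) := by
  rw [setLIntegral_congr_fun (g := fun z => ENNReal.ofReal (h z * χ z.1)) hs fun z hz => by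
    simp only [hχ z hz, mul_one]]
  exact lintegral_mono_set hst

theorem tendsto_initial {Ω : Set ℝ} {T : ℝ} (hT : 0 < T) {w : ℝ → ℝ → ℝ}
    (hwc : ContinuousOn (fun p : ℝ × ℝ => w p.1 p.2) (Ω ×ˢ Icc 0 T)) {x : ℝ} (hx : x ∈ Ω) :
    Tendsto (w x) (𝓝[>] 0) (𝓝 (w x 0)) := by
  refine ((ContinuousOn.slice_right hwc hx) 0 ⟨le_rfl, hT.le⟩).mono_left ?_
  rw [← nhdsWithin_Ioo_eq_nhdsGT hT]
  exact nhdsWithin_mono _ Ioo_subset_Icc_self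

theorem plateauBound_of_classical {Ω I : Set ℝ} (hΩI : Ω ⊆ I) (hΩ : MeasurableSet Ω) {d T M : ℝ}
    (hd : 0 ≤ d) (hT : 0 < T) (hM : 0 ≤ M) {w wx wxx wt : ℝ → ℝ → ℝ} {h : ℝ → ℝ → ℝ} {w₀ : ℝ → ℝ}
    (hw : HasC21Derivs I (Ioc 0 T) w wx wxx wt)
    (hwc : ContinuousOn (fun p : ℝ × ℝ => w p.1 p.2) (Ω ×ˢ Icc 0 T))
    (hini : ∀ x ∈ Ω, w x 0 = w₀ x)
    (hw0 : ∀ x ∈ Ω, ∀ t ∈ Ioo 0 T, 0 ≤ w x t ∧ w x t ≤ M)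
    (heq : ∀ x ∈ Ω, ∀ t ∈ Ioo 0 T, wt x t = d * wxx x t - h x t)
    (hh : ∀ x ∈ Ω, ∀ t ∈ Ioo 0 T, 0 ≤ h x t) :
    PlateauBound Ω T M d w₀ fun z => h z.1 z.2 := by
  intro a b ε K χ χ₁ χ₂ hχ hε hab hsub
  have ha0 : χ a = 0 := hχ.eq_zero a fun h => lt_irrefl _ h.1
  have hb0 : χ b = 0 := hχ.eq_zero b fun h => lt_irrefl _ h.2
  have hsub' : Ioo a b ⊆ Ω := Ioo_subset_Icc_self.trans hsub
  refine (setLIntegral_le_of_eq_one (t := Ioo a b ×ˢ Ioo 0 T) (χ := χ) (prod_mono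
    (Icc_subset_Ioo (by linarith) (by linarith)) le_rfl) (measurableSet_Icc.prod measurableSet_Ioo)
    fun z hz => hχ.eq_one _ hz.1).trans ?_
  refine (hχ.setLIntegral_le_of_classical (w₀ := w₀) hab hb0 (hχ.deriv_eq_zero ha0) hd hT hM
    (hw.mono (hsub.trans hΩI) le_rfl) (fun t _ => by simp [ha0]) (fun x hx => hw0 x (hsub' hx))
    (fun x hx => ?_) (fun x hx => heq x (hsub' hx)) (fun x hx => hh x (hsub' hx))).trans
    (le_of_eq ?_)
  · rw [← hini x (hsub' hx)]
    exact tendsto_initial hT hwc (hsub' hx)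
  · rw [setIntegral_eq_of_subset_of_forall_sdiff_eq_zero hΩ hsub' fun x hx => by
      rw [hχ.eq_zero x hx.2, mul_zero]]

theorem plateauBound_of_weak {Ω : Set ℝ} (hΩ : MeasurableSet Ω) {d T M H : ℝ}
    (hd : 0 ≤ d) (hT : 0 < T) (hM : 0 ≤ M) {w h : ℝ × ℝ → ℝ} {w₀ : ℝ → ℝ}
    (hwm : AEStronglyMeasurable w (volume.restrict (strip Ω T)))
    (hhm : AEStronglyMeasurable h (volume.restrict (strip Ω T)))
    (hw : ∀ᵐ z ∂volume.restrict (strip Ω T), 0 ≤ w z ∧ w z ≤ M)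
    (hh : ∀ᵐ z ∂volume.restrict (strip Ω T), 0 ≤ h z ∧ h z ≤ H)
    (hid : ∀ ⦃a b ε K : ℝ⦄ ⦃χ χ₁ χ₂ : ℝ → ℝ⦄, IsCutoff a b ε K χ χ₁ χ₂ → Icc a b ⊆ Ω →
      ∀ n, (∫ z in strip Ω T, w z * (χ z.1 * timeCutoffDeriv T n z.2))
      + (∫ z in strip Ω T, (d * w z * (χ₂ z.1 * timeCutoff T n z.2)
        - h z * (χ z.1 * timeCutoff T n z.2)))
      = - ∫ x in Ω, w₀ x * (χ x * timeCutoff T n 0)) :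
    PlateauBound Ω T M d w₀ h := by
  intro a b ε K χ χ₁ χ₂ hχ hε hab hsub
  refine (setLIntegral_le_of_eq_one (t := strip Ω T) (χ := χ) (prod_mono
    ((Icc_subset_Icc (by linarith) (by linarith)).trans hsub) le_rfl)
    (measurableSet_Icc.prod measurableSet_Ioo) fun z hz => hχ.eq_one _ hz.1).trans ?_
  exact hχ.setLIntegral_le_of_weak hΩ hd hT hM hwm hhm hw hh (hid hχ hsub)

section Solutions

variable {F : ℝ → ℝ → ℝ} {T du dv k M U₀ : ℝ} {u₀ v₀ : ℝ → ℝ} {u v : ℝ → ℝ → ℝ}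

theorem aestronglyMeasurable_strip {Ω : Set ℝ} (hΩ : MeasurableSet Ω) {w : ℝ → ℝ → ℝ}
    (hw : ContinuousOn (fun p : ℝ × ℝ => w p.1 p.2) (Ω ×ˢ Icc 0 T)) :
    AEStronglyMeasurable (fun p : ℝ × ℝ => w p.1 p.2) (volume.restrict (strip Ω T)) :=
  (hw.mono (prod_mono le_rfl Ioo_subset_Icc_self)).aestronglyMeasurable
    (hΩ.prod measurableSet_Ioo)

theorem IsSolutionLine.aestronglyMeasurable (h : IsSolutionLine F T du dv k u₀ v₀ u v) :
    AEStronglyMeasurable (fun p : ℝ × ℝ => u p.1 p.2) (volume.restrict (strip univ T)) ∧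
    AEStronglyMeasurable (fun p : ℝ × ℝ => v p.1 p.2) (volume.restrict (strip univ T)) := by
  rcases h with ⟨-, h⟩ | ⟨-, h⟩
  · exact ⟨aestronglyMeasurable_strip MeasurableSet.univ h.1,
      aestronglyMeasurable_strip MeasurableSet.univ h.2.1⟩
  · exact ⟨h.1.1, h.2.1.1⟩

theorem IsSolutionHalfLine.aestronglyMeasurable
    (h : IsSolutionHalfLine F T du dv k U₀ u₀ v₀ u v) :
    AEStronglyMeasurable (fun p : ℝ × ℝ => u p.1 p.2) (volume.restrict (strip (Ioi 0) T)) ∧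
    AEStronglyMeasurable (fun p : ℝ × ℝ => v p.1 p.2) (volume.restrict (strip (Ioi 0) T)) := by
  rcases h with ⟨-, h⟩ | ⟨-, h⟩
  · exact ⟨aestronglyMeasurable_strip measurableSet_Ioi h.1,
      aestronglyMeasurable_strip measurableSet_Ioi h.2.1⟩
  · exact ⟨h.1.1, h.2.1.1⟩

theorem IsSolutionLine.plateauBound (hF : IsReaction F) (hT : 0 < T) (hdu : 0 ≤ du) (hM : 0 ≤ M)
    (hk : 0 ≤ k) (h : IsSolutionLine F T du dv k u₀ v₀ u v) (hB : Between univ T M u v) :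
    PlateauBound univ T M du u₀ (fun z => k * F (u z.1 z.2) (v z.1 z.2)) ∧
    PlateauBound univ T M dv v₀ (fun z => k * F (u z.1 z.2) (v z.1 z.2)) := by
  have hm := h.aestronglyMeasurable
  rcases h with ⟨hdv, huc, hvc, hini, ux, uxx, ut, vx, vxx, vt, hu, hv, heq⟩ | ⟨rfl, hu, hv, h⟩
  · have hb := hB.forall isOpen_univ huc hvc
    have hh : ∀ x ∈ univ, ∀ t ∈ Ioo 0 T, 0 ≤ k * F (u x t) (v x t) := fun x hx t ht =>
      mul_nonneg hk (hF.nonneg (hb x hx t ht).1.1 (hb x hx t ht).2.1)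
    exact ⟨plateauBound_of_classical (h := fun x t => k * F (u x t) (v x t)) le_rfl
        MeasurableSet.univ hdu hT hM hu huc (fun x _ => (hini x).1)
        (fun x hx t ht => (hb x hx t ht).1) (fun x _ t ht => (heq x t ht).1) hh,
      plateauBound_of_classical (h := fun x t => k * F (u x t) (v x t)) le_rfl
        MeasurableSet.univ hdv.le hT hM hv hvc (fun x _ => (hini x).2)
        (fun x hx t ht => (hb x hx t ht).2) (fun x _ t ht => (heq x t ht).2) hh⟩
  · have hhm := hF.aestronglyMeasurable hM k hm.1 hm.2 hB
    have hh := hF.ae_bounds hk hB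
    refine ⟨plateauBound_of_weak MeasurableSet.univ hdu hT hM hm.1 hhm
        (hB.mono fun p hp => ⟨hp.1, hp.2.1⟩) hh fun a b ε K χ χ₁ χ₂ hχ _ n => ?_,
      plateauBound_of_weak MeasurableSet.univ le_rfl hT hM hm.2 hhm
        (hB.mono fun p hp => hp.2.2) hh fun a b ε K χ χ₁ χ₂ hχ _ n => ?_⟩
    · rw [setIntegral_univ]
      exact (h _ _ _ _ (hχ.isTest univ hT n)).1
    · rw [setIntegral_univ, ← (h _ _ _ _ (hχ.isTest univ hT n)).2, ← sub_eq_zero]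
      simp only [zero_mul, zero_sub, integral_neg]
      ring

/-- The cut-offs are supported inside the open half-line, so neither boundary condition enters; in
the weak form, `χ 0 = 0` forces `χ₁ 0 = 0` and the term with `U₀` disappears. -/
theorem IsSolutionHalfLine.plateauBound (hF : IsReaction F) (hT : 0 < T) (hdu : 0 ≤ du)
    (hM : 0 ≤ M) (hk : 0 ≤ k) (h : IsSolutionHalfLine F T du dv k U₀ u₀ v₀ u v)
    (hB : Between (Ioi 0) T M u v) :
    PlateauBound (Ioi 0) T M du u₀ (fun z => k * F (u z.1 z.2) (v z.1 z.2)) ∧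
    PlateauBound (Ioi 0) T M dv v₀ (fun z => k * F (u z.1 z.2) (v z.1 z.2)) := by
  have hm := h.aestronglyMeasurable
  rcases h with ⟨hdv, huc, hvc, hini, ux, uxx, ut, vx, vxx, vt, hu, hv, -, heq⟩ | ⟨rfl, hu, hv, h⟩
  · have hb := hB.forall isOpen_Ioi huc hvc
    have hh : ∀ x ∈ Ioi (0 : ℝ), ∀ t ∈ Ioo 0 T, 0 ≤ k * F (u x t) (v x t) := fun x hx t ht =>
      mul_nonneg hk (hF.nonneg (hb x hx t ht).1.1 (hb x hx t ht).2.1)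
    exact ⟨plateauBound_of_classical (h := fun x t => k * F (u x t) (v x t)) Ioi_subset_Ici_self
        measurableSet_Ioi hdu hT hM hu huc (fun x hx => (hini x hx).1)
        (fun x hx t ht => (hb x hx t ht).1) (fun x hx t ht => (heq x hx t ht).1) hh,
      plateauBound_of_classical (h := fun x t => k * F (u x t) (v x t)) Ioi_subset_Ici_self
        measurableSet_Ioi hdv.le hT hM hv hvc (fun x hx => (hini x hx).2)
        (fun x hx t ht => (hb x hx t ht).2) (fun x hx t ht => (heq x hx t ht).2) hh⟩
  · have hhm := hF.aestronglyMeasurable hM k hm.1 hm.2 hB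
    have hh := hF.ae_bounds hk hB
    have hχ0 : ∀ {a b ε K : ℝ} {χ χ₁ χ₂ : ℝ → ℝ}, IsCutoff a b ε K χ χ₁ χ₂ → Icc a b ⊆ Ioi 0 →
        χ 0 = 0 := fun hχ hab => hχ.eq_zero 0 fun h0 =>
      lt_irrefl (0 : ℝ) (hab (Ioo_subset_Icc_self h0))
    refine ⟨plateauBound_of_weak measurableSet_Ioi hdu hT hM hm.1 hhm
        (hB.mono fun p hp => ⟨hp.1, hp.2.1⟩) hh fun a b ε K χ χ₁ χ₂ hχ hab n => ?_,
      plateauBound_of_weak measurableSet_Ioi le_rfl hT hM hm.2 hhm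
        (hB.mono fun p hp => hp.2.2) hh fun a b ε K χ χ₁ χ₂ hχ hab n => ?_⟩
    · have h0 := hχ0 hχ hab
      have := (h _ _ _ _ (hχ.isTest (Ici 0) hT n) fun t _ => by simp [h0]).1
      simpa only [hχ.deriv_eq_zero h0, zero_mul, integral_zero, mul_zero, sub_zero] using this
    · have h0 := hχ0 hχ hab
      rw [← (h _ _ _ _ (hχ.isTest (Ici 0) hT n) fun t _ => by simp [h0]).2, ← sub_eq_zero]
      simp only [zero_mul, zero_sub, integral_neg]
      ring

/-! ### Mass of the initial data, and the region near the boundary -/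

/-- Split `w = (w - f) + f`. The reference profile `f` can be positive on the support of `χ` only
inside `s`, where it is at most `M`. -/
theorem setIntegral_mul_le {Ω s : Set ℝ} (hΩ : MeasurableSet Ω) (hs : MeasurableSet s)
    (hsv : volume s ≠ ∞) {w f χ : ℝ → ℝ} (hM : 0 ≤ M) (hw : ∀ x ∈ Ω, 0 ≤ w x)
    (hχ0 : ∀ x, 0 ≤ χ x) (hχ1 : ∀ x, χ x ≤ 1) (hi : IntegrableOn (fun x => w x - f x) Ω)
    (hf : ∀ x ∈ Ω, x ∉ s → χ x ≠ 0 → f x ≤ 0) (hfM : ∀ x ∈ Ω, f x ≤ M) :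
    ∫ x in Ω, w x * χ x ≤ (∫ x in Ω, |w x - f x|) + M * volume.real s := by
  have hind : Integrable (s.indicator fun _ => M) :=
    (integrable_indicator_iff hs).2 (integrableOn_const hsv)
  calc ∫ x in Ω, w x * χ x ≤ ∫ x in Ω, (|w x - f x| + s.indicator (fun _ => M) x) := by
        refine integral_mono_of_nonneg ?_ (hi.abs.add hind.integrableOn) ?_
        · filter_upwards [ae_restrict_mem hΩ] with x hx using mul_nonneg (hw x hx) (hχ0 x)
        · filter_upwards [ae_restrict_mem hΩ] with x hx
          have h1 : (w x - f x) * χ x ≤ |w x - f x| :=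
            (mul_le_mul_of_nonneg_right (le_abs_self _) (hχ0 x)).trans
              (mul_le_of_le_one_right (abs_nonneg _) (hχ1 x))
          have h2 : f x * χ x ≤ s.indicator (fun _ => M) x := by
            by_cases hxs : x ∈ s
            · rw [indicator_of_mem hxs]
              exact (mul_le_mul_of_nonneg_right (hfM x hx) (hχ0 x)).trans
                (mul_le_of_le_one_right hM (hχ1 x))
            · rw [indicator_of_notMem hxs]
              by_cases h0 : χ x = 0
              · simp [h0]
              · exact mul_nonpos_of_nonpos_of_nonneg (hf x hx hxs h0) (hχ0 x)
          calc w x * χ x = (w x - f x) * χ x + f x * χ x := by ring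
            _ ≤ _ := add_le_add h1 h2
    _ = (∫ x in Ω, |w x - f x|) + ∫ x in Ω, s.indicator (fun _ => M) x :=
        integral_add hi.abs hind.integrableOn
    _ ≤ (∫ x in Ω, |w x - f x|) + ∫ x, s.indicator (fun _ => M) x := by
        exact add_le_add le_rfl (setIntegral_le_integral hind
          (Eventually.of_forall fun x => indicator_nonneg (fun _ _ => hM) x))
    _ = _ := by
        rw [integral_indicator hs, setIntegral_const, smul_eq_mul, mul_comm]

/-- The reaction term near the boundary point: the whole Neumann problem for `v` is tested when
`d_v > 0`, while for `d_v = 0` no boundary condition is needed. -/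
theorem IsSolutionHalfLine.setLIntegral_near_zero_le (hF : IsReaction F) (hT : 0 < T)
    (hdu : 0 ≤ du) (hM : 0 ≤ M) (hk : 0 ≤ k) {K : ℝ}
    (hcut : ∀ a b ε : ℝ, 0 < ε → a + 2 * ε ≤ b →
      ∃ χ χ₁ χ₂ : ℝ → ℝ, IsCutoff a b ε (K / ε) χ χ₁ χ₂)
    (hv₀ : ∀ x ∈ Ioi (0 : ℝ), 0 ≤ v₀ x ∧ v₀ x ≤ M)
    (h : IsSolutionHalfLine F T du dv k U₀ u₀ v₀ u v) (hB : Between (Ioi 0) T M u v) :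
    ∫⁻ z in Ioc 0 3 ×ˢ Ioo 0 T, ENNReal.ofReal (k * F (u z.1 z.2) (v z.1 z.2))
      ≤ ENNReal.ofReal (4 * M + dv * M * T * K) := by
  have hdata : ∀ {a ε K : ℝ} {χ χ₁ χ₂ : ℝ → ℝ}, IsCutoff a 4 ε K χ χ₁ χ₂ →
      ∫ x in Ioi 0, v₀ x * χ x ≤ 4 * M := fun {a ε K χ χ₁ χ₂} hχ => by
    -- With `f = v₀` the difference term is zero, and `4M` is `M` times the length of `[0, 4]`.
    refine (setIntegral_mul_le (s := Icc 0 4) (f := v₀) (M := M) measurableSet_Ioi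
      measurableSet_Icc (by simp) hM (fun x hx => (hv₀ x hx).1) hχ.nonneg hχ.le_one (by simp)
      (fun x hx hxs hx0 => absurd (hχ.eq_zero x fun hx' => hxs ⟨hx.le, hx'.2.le⟩) hx0)
      (fun x hx => (hv₀ x hx).2)).trans (le_of_eq ?_)
    simp [measureReal_def, mul_comm]
  have hpl := (h.plateauBound hF hT hdu hM hk hB).2
  rcases h with ⟨hdv, huc, hvc, hini, ux, uxx, ut, vx, vxx, vt, hu, hv, hbd, heq⟩ | ⟨rfl, -⟩
  · have hb := hB.forall isOpen_Ioi huc hvc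
    -- The plateau is `[0, 3]`: the left ramp lies outside the domain, so `χ₁ 0 = 0`, and the flux
    -- at `0` is killed by the Neumann condition.
    obtain ⟨χ, χ₁, χ₂, hχ⟩ := hcut (-1) 4 1 one_pos (by norm_num)
    refine (setLIntegral_le_of_eq_one (t := Ioo 0 4 ×ˢ Ioo 0 T) (χ := χ) (prod_mono
      (fun x hx => ⟨hx.1, by linarith [hx.2]⟩) le_rfl)
      (measurableSet_Ioc.prod measurableSet_Ioo)
      fun z hz => hχ.eq_one _ ⟨by linarith [hz.1.1], by linarith [hz.1.2]⟩).trans ?_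
    have h4 : χ 4 = 0 := hχ.eq_zero 4 fun h => lt_irrefl _ h.2
    refine (hχ.setLIntegral_le_of_classical (w₀ := v₀) (h := fun x t => k * F (u x t) (v x t))
      (by norm_num) h4
      (hχ.deriv_eq_zero' (hχ.eq_one 0 ⟨by norm_num, by norm_num⟩)) hdv.le hT hM
      (hv.mono Icc_subset_Ici_self le_rfl)
      (fun t ht => by rw [← mul_assoc, (hbd t ht).2, zero_mul])
      (fun x hx t ht => (hb x hx.1 t ht).2)
      (fun x hx => by rw [← (hini x hx.1).2]; exact tendsto_initial hT hvc hx.1)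
      (fun x hx t ht => (heq x hx.1 t ht).2)
      (fun x hx t ht => mul_nonneg hk
        (hF.nonneg (hb x hx.1 t ht).1.1 (hb x hx.1 t ht).2.1))).trans
      (ENNReal.ofReal_le_ofReal ?_)
    rw [div_one]
    refine add_le_add_left ?_ _
    rw [← setIntegral_eq_of_subset_of_forall_sdiff_eq_zero measurableSet_Ioi
      (Ioo_subset_Ioi_self : Ioo (0 : ℝ) 4 ⊆ Ioi 0) fun x hx => by
        rw [hχ.eq_zero x fun hx' => hx.2 ⟨hx.1, hx'.2⟩, mul_zero]]
    exact hdata hχ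
  -- The ramp over `[e n, 2 e n]` has a second derivative of norm up to `K / e n`, but it is
  -- multiplied by `d_v = 0`.
  · set e : ℕ → ℝ := fun n => 1 / ((n : ℝ) + 1) with he
    have he0 : ∀ n, 0 < e n := fun n => by simp only [he]; positivity
    have he1 : ∀ n, e n ≤ 1 := fun n => by
      simp only [he]
      rw [div_le_one (by positivity)]
      have : (0 : ℝ) ≤ n := Nat.cast_nonneg n
      linarith
    have hanti : Antitone e := fun n m hnm => by
      simp only [he]
      have : (n : ℝ) ≤ m := Nat.cast_le.2 hnm
      gcongr
    have hmono : Monotone fun n => Icc (e n + e n) 3 ×ˢ Ioo 0 T := fun n m hnm =>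
      prod_mono (Icc_subset_Icc (add_le_add (hanti hnm) (hanti hnm)) le_rfl) le_rfl
    have hunion : Ioc 0 3 ×ˢ Ioo 0 T ⊆ ⋃ n, Icc (e n + e n) 3 ×ˢ Ioo 0 T := fun z hz => by
      obtain ⟨n, hn⟩ := exists_nat_one_div_lt (half_pos hz.1.1)
      exact mem_iUnion.2 ⟨n, ⟨by simp only [he]; linarith, hz.1.2⟩, hz.2⟩
    refine (lintegral_mono_set hunion).trans ?_
    rw [setLIntegral_iUnion_of_directed _ hmono.directed_le]
    refine iSup_le fun n => ?_
    obtain ⟨χ, χ₁, χ₂, hχ⟩ := hcut (e n) 4 (e n) (he0 n) (by linarith [he1 n])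
    refine (lintegral_mono_set (Set.prod_mono (Icc_subset_Icc le_rfl (by linarith [he1 n]))
      le_rfl)).trans ((hpl hχ (he0 n) (by linarith [he1 n]) fun x hx => (he0 n).trans_le hx.1).trans
      (ENNReal.ofReal_le_ofReal ?_))
    simpa using hdata hχ

end Solutions

/-! ### Bounds uniform in `k`, and exhaustion of half-lines -/

theorem integral_abs_le_of_eLpNorm_le {μ : Measure ℝ} {f : ℝ → ℝ} {B : ℝ} (hf : MemLp f 1 μ)
    (hB : 0 ≤ B) (h : eLpNorm f 1 μ ≤ ENNReal.ofReal B) : ∫ x, |f x| ∂μ ≤ B := by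
  rw [eLpNorm_one_eq_lintegral_enorm] at h
  have := integral_norm_eq_lintegral_enorm hf.1
  simp only [Real.norm_eq_abs] at this
  rw [this]
  exact ENNReal.toReal_le_of_le_ofReal hB h

/-- Large `k` is covered by the limit at infinity, the rest by compactness of `[0, k₀]`; the
continuous extension to `k = 0` excludes blow-up as `k → 0`. -/
theorem ContinuousIntoL1.exists_bound {f : ℝ → ℝ → ℝ} (hf : ContinuousIntoL1 f)
    (hm : ∀ k, 0 < k → MemLp (f k) 1 volume)
    (hlim : Tendsto (fun k => eLpNorm (f k) 1 volume) atTop (𝓝 0)) :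
    ∃ B : ℝ, 0 ≤ B ∧ ∀ k, 0 < k → ∫ x, |f k x| ≤ B := by
  obtain ⟨g, hg, hgf⟩ := hf
  obtain ⟨k₀, hk₀⟩ := eventually_atTop.1 (hlim.eventually_le_const (zero_lt_one' ℝ≥0∞))
  obtain ⟨C, hC⟩ := isCompact_Icc.exists_bound_of_continuousOn
    (hg.mono (Icc_subset_Ici_self : Icc 0 k₀ ⊆ Ici 0))
  refine ⟨max C 1, le_max_of_le_right zero_le_one, fun k hk => ?_⟩
  refine integral_abs_le_of_eLpNorm_le (hm k hk) (le_max_of_le_right zero_le_one) ?_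
  rcases le_total k k₀ with h | h
  · rw [← eLpNorm_congr_ae (hgf k hk), ← ENNReal.ofReal_toReal (Lp.eLpNorm_ne_top (g k))]
    exact ENNReal.ofReal_le_ofReal ((hC k ⟨hk.le, h⟩).trans (le_max_left _ _))
  · refine (hk₀ k h).trans ?_
    rw [← ENNReal.ofReal_one]
    exact ENNReal.ofReal_le_ofReal (le_max_right _ _)

section

variable {Ω : Set ℝ} {T M d A K c : ℝ} {w₀ : ℝ → ℝ} {h : ℝ × ℝ → ℝ}

theorem PlateauBound.setLIntegral_Ici_le (hP : PlateauBound Ω T M d w₀ h)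
    (hcut : ∀ a b ε : ℝ, 0 < ε → a + 2 * ε ≤ b →
      ∃ χ χ₁ χ₂ : ℝ → ℝ, IsCutoff a b ε (K / ε) χ χ₁ χ₂)
    (hΩ : Ici (c - 1) ⊆ Ω)
    (hA : ∀ b χ χ₁ χ₂, IsCutoff (c - 1) b 1 K χ χ₁ χ₂ → ∫ x in Ω, w₀ x * χ x ≤ A) :
    ∫⁻ z in Ici c ×ˢ Ioo 0 T, ENNReal.ofReal (h z) ≤ ENNReal.ofReal (A + d * M * T * K) := by
  have hmono : Monotone fun n : ℕ => Icc c (c + n) ×ˢ Ioo 0 T := fun n m hnm =>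
    Set.prod_mono (Icc_subset_Icc le_rfl (by gcongr)) le_rfl
  have hunion : Ici c ×ˢ Ioo 0 T ⊆ ⋃ n : ℕ, Icc c (c + n) ×ˢ Ioo 0 T := fun z hz => by
    obtain ⟨n, hn⟩ := exists_nat_ge (z.1 - c)
    exact mem_iUnion.2 ⟨n, ⟨hz.1, by linarith⟩, hz.2⟩
  refine (lintegral_mono_set hunion).trans ?_
  rw [setLIntegral_iUnion_of_directed _ hmono.directed_le]
  refine iSup_le fun n => ?_
  have hn : (0 : ℝ) ≤ n := Nat.cast_nonneg n
  -- Ramps of width `1` keep the norm of `χ₂` below `K` for every `n`.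
  obtain ⟨χ, χ₁, χ₂, hχ⟩ := hcut (c - 1) (c + n + 1) 1 one_pos (by linarith)
  rw [div_one] at hχ
  refine (lintegral_mono_set (Set.prod_mono (Icc_subset_Icc (by linarith) (by linarith))
    le_rfl)).trans ((hP hχ one_pos (by linarith) (Icc_subset_Ici_self.trans hΩ)).trans
    (ENNReal.ofReal_le_ofReal ?_))
  exact add_le_add (hA _ _ _ _ hχ) le_rfl

theorem PlateauBound.setLIntegral_Iic_le (hP : PlateauBound Ω T M d w₀ h)
    (hcut : ∀ a b ε : ℝ, 0 < ε → a + 2 * ε ≤ b →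
      ∃ χ χ₁ χ₂ : ℝ → ℝ, IsCutoff a b ε (K / ε) χ χ₁ χ₂)
    (hΩ : Iic (c + 1) ⊆ Ω)
    (hA : ∀ a χ χ₁ χ₂, IsCutoff a (c + 1) 1 K χ χ₁ χ₂ → ∫ x in Ω, w₀ x * χ x ≤ A) :
    ∫⁻ z in Iic c ×ˢ Ioo 0 T, ENNReal.ofReal (h z) ≤ ENNReal.ofReal (A + d * M * T * K) := by
  have hmono : Monotone fun n : ℕ => Icc (c - n) c ×ˢ Ioo 0 T := fun n m hnm =>
    Set.prod_mono (Icc_subset_Icc (by gcongr) le_rfl) le_rfl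
  have hunion : Iic c ×ˢ Ioo 0 T ⊆ ⋃ n : ℕ, Icc (c - n) c ×ˢ Ioo 0 T := fun z hz => by
    obtain ⟨n, hn⟩ := exists_nat_ge (c - z.1)
    exact mem_iUnion.2 ⟨n, ⟨by linarith, hz.1⟩, hz.2⟩
  refine (lintegral_mono_set hunion).trans ?_
  rw [setLIntegral_iUnion_of_directed _ hmono.directed_le]
  refine iSup_le fun n => ?_
  have hn : (0 : ℝ) ≤ n := Nat.cast_nonneg n
  obtain ⟨χ, χ₁, χ₂, hχ⟩ := hcut (c - n - 1) (c + 1) 1 one_pos (by linarith)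
  rw [div_one] at hχ
  refine (lintegral_mono_set (Set.prod_mono (Icc_subset_Icc (by linarith) (by linarith))
    le_rfl)).trans ((hP hχ one_pos (by linarith) (Icc_subset_Iic_self.trans hΩ)).trans
    (ENNReal.ofReal_le_ofReal ?_))
  exact add_le_add (hA _ _ _ _ hχ) le_rfl

end

/-! ### The two uniform bounds -/

section Main

variable {F : ℝ → ℝ → ℝ} {T du U₀ V₀ M : ℝ}

theorem exists_reactionBound_line (hF : IsReaction F) (hT : 0 < T) (hdu : 0 < du) (hU₀ : 0 < U₀)
    (hM : max U₀ V₀ ≤ M) {u₀ v₀ : ℝ → ℝ → ℝ} (hd : IsLineData U₀ V₀ M u₀ v₀) {D : ℝ} (hD : 0 < D) :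
    ∃ C : ℝ, 0 < C ∧ ∀ dv : ℝ, 0 ≤ dv → dv ≤ D → ∀ k : ℝ, 0 < k → ∀ u v : ℝ → ℝ → ℝ,
      IsSolutionLine F T du dv k (u₀ k) (v₀ k) u v → Between univ T M u v →
      ReactionBound univ F T k C u v := by
  have hUM : U₀ ≤ M := (le_max_left _ _).trans hM
  have hVM : V₀ ≤ M := (le_max_right _ _).trans hM
  have hM0 : 0 < M := hU₀.trans_le hUM
  obtain ⟨K, hK, hcut⟩ := exists_isCutoff
  obtain ⟨Bu, hBu, hu1⟩ := hd.continuous_u.exists_bound hd.memL1_u hd.limit_u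
  obtain ⟨Bv, hBv, hv1⟩ := hd.continuous_v.exists_bound hd.memL1_v hd.limit_v
  refine ⟨Bu + M + du * M * T * K + (Bv + M + D * M * T * K), by positivity,
    fun dv hdv hdvD k hk u v hs hB => ?_⟩
  have hm := hs.aestronglyMeasurable
  refine reactionBound_of_setLIntegral_le (hF.aestronglyMeasurable hM0.le k hm.1 hm.2 hB)
    ((hF.ae_bounds hk.le hB).mono fun p hp => hp.1) (by positivity) ?_
  obtain ⟨hPu, hPv⟩ := hs.plateauBound hF hT hdu.le hM0.le hk.le hB
  have hr := hPu.setLIntegral_Ici_le (c := 0) (A := Bu + M) hcut (subset_univ _)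
    fun b χ χ₁ χ₂ hχ => by
      -- The left ramp reaches into `x < 0`, where the profile equals `U₀ ≤ M`; this unit interval
      -- contributes the extra `M`.
      refine (setIntegral_mul_le (s := Icc (-1) 0) (f := uInf U₀) MeasurableSet.univ
        measurableSet_Icc (by simp) hM0.le (fun x _ => (hd.bound_u k hk x).1) hχ.nonneg hχ.le_one
        (memLp_one_iff_integrable.1 (hd.memL1_u k hk)).integrableOn (fun x _ hx hx0 => ?_)
        fun x _ => ?_).trans ?_
      · have hx1 : x ∈ Ioo (0 - 1) b := by_contra fun h => hx0 (hχ.eq_zero x h)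
        have : ¬ x < 0 := fun h => hx ⟨by linarith [hx1.1], h.le⟩
        simp [uInf, this]
      · unfold uInf; split_ifs <;> linarith
      · rw [setIntegral_univ]
        exact add_le_add (hu1 k hk) (by simp [measureReal_def])
  have hl := hPv.setLIntegral_Iic_le (c := 0) (A := Bv + M) hcut (subset_univ _)
    fun a χ χ₁ χ₂ hχ => by
      refine (setIntegral_mul_le (s := Icc 0 1) (f := vInf V₀) MeasurableSet.univ
        measurableSet_Icc (by simp) hM0.le (fun x _ => (hd.bound_v k hk x).1) hχ.nonneg hχ.le_one
        (memLp_one_iff_integrable.1 (hd.memL1_v k hk)).integrableOn (fun x _ hx hx0 => ?_)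
        fun x _ => ?_).trans ?_
      · have hx1 : x ∈ Ioo a (0 + 1) := by_contra fun h => hx0 (hχ.eq_zero x h)
        have : x < 0 := by_contra fun h => hx ⟨not_lt.1 h, by linarith [hx1.2]⟩
        simp [vInf, this]
      · unfold vInf; split_ifs <;> linarith
      · rw [setIntegral_univ]
        exact add_le_add (hv1 k hk) (by simp [measureReal_def])
  have hsplit : strip univ T ⊆ Ici 0 ×ˢ Ioo 0 T ∪ Iic 0 ×ˢ Ioo 0 T := fun z hz =>
    (le_total 0 z.1).imp (fun h => ⟨h, hz.2⟩) fun h => ⟨h, hz.2⟩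
  refine (lintegral_mono_set hsplit).trans ((lintegral_union_le _ _ _).trans
    ((add_le_add hr hl).trans ?_))
  rw [← ENNReal.ofReal_add (by positivity) (by positivity)]
  refine ENNReal.ofReal_le_ofReal ?_
  gcongr

theorem exists_reactionBound_halfLine (hF : IsReaction F) (hT : 0 < T) (hdu : 0 < du)
    (hU₀ : 0 < U₀) (hM : max U₀ V₀ ≤ M) {u₀ v₀ : ℝ → ℝ → ℝ} (hd : IsHalfLineData U₀ V₀ M u₀ v₀)
    {D : ℝ} (hD : 0 < D) :
    ∃ C : ℝ, 0 < C ∧ ∀ dv : ℝ, 0 ≤ dv → dv ≤ D → ∀ k : ℝ, 0 < k → ∀ u v : ℝ → ℝ → ℝ,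
      IsSolutionHalfLine F T du dv k U₀ (u₀ k) (v₀ k) u v → Between (Ioi 0) T M u v →
      ReactionBound (Ioi 0) F T k C u v := by
  have hM0 : 0 < M := hU₀.trans_le ((le_max_left _ _).trans hM)
  obtain ⟨K, hK, hcut⟩ := exists_isCutoff
  obtain ⟨B, hBu⟩ := hd.bounded_u
  -- The bound `B` is not assumed nonnegative, hence `max B 0`. The first two terms come from `u` on
  -- `x ≥ 3`, the others from `v` on `0 < x ≤ 3`.
  refine ⟨max B 0 + du * M * T * K + (4 * M + D * M * T * K), by positivity,
    fun dv hdv hdvD k hk u v hs hB => ?_⟩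
  have hm := hs.aestronglyMeasurable
  refine reactionBound_of_setLIntegral_le (hF.aestronglyMeasurable hM0.le k hm.1 hm.2 hB)
    ((hF.ae_bounds hk.le hB).mono fun p hp => hp.1) (by positivity) ?_
  have hPu := (hs.plateauBound hF hT hdu.le hM0.le hk.le hB).1
  have hr := hPu.setLIntegral_Ici_le (c := 3) (A := max B 0) hcut
    (fun x hx => by
      have : 3 - 1 ≤ x := hx
      exact mem_Ioi.2 (by linarith)) fun b χ χ₁ χ₂ hχ => by
      refine (setIntegral_mul_le (s := ∅) (f := uInf U₀) measurableSet_Ioi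
        MeasurableSet.empty (by simp) hM0.le (fun x hx => (hd.bound_u k hk x (le_of_lt hx)).1)
        hχ.nonneg hχ.le_one (memLp_one_iff_integrable.1 (hd.memL1_u k hk)) (fun x hx _ _ => ?_)
        fun x hx => ?_).trans ?_
      · have : ¬ x < 0 := not_lt.2 (le_of_lt hx)
        simp [uInf, this]
      · have : ¬ x < 0 := not_lt.2 (le_of_lt hx)
        simp [uInf, this, hM0.le]
      · simpa using integral_abs_le_of_eLpNorm_le (hd.memL1_u k hk) (le_max_right B 0)
          ((hBu k hk).trans (ENNReal.ofReal_le_ofReal (le_max_left _ _)))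
  have hl := hs.setLIntegral_near_zero_le hF hT hdu.le hM0.le hk.le hcut
    (fun x hx => hd.bound_v k hk x (le_of_lt hx)) hB
  have hsplit : strip (Ioi 0) T ⊆ Ici 3 ×ˢ Ioo 0 T ∪ Ioc 0 3 ×ˢ Ioo 0 T := fun z hz =>
    (le_total 3 z.1).imp (fun h => ⟨h, hz.2⟩) fun h => ⟨⟨hz.1, h⟩, hz.2⟩
  refine (lintegral_mono_set hsplit).trans ((lintegral_union_le _ _ _).trans
    ((add_le_add hr hl).trans ?_))
  rw [← ENNReal.ofReal_add (by positivity) (by positivity)]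
  refine ENNReal.ofReal_le_ofReal ?_
  gcongr

end Main

end FastReaction

theorem lemma2 (F : ℝ → ℝ → ℝ) (hF : FastReaction.IsReaction F)
    (T du U₀ V₀ M : ℝ) (hT : 0 < T) (hdu : 0 < du) (hU₀ : 0 < U₀) (hV₀ : 0 < V₀)
    (hM : max U₀ V₀ ≤ M) :
    (∀ u₀ v₀ : ℝ → ℝ → ℝ, FastReaction.IsLineData U₀ V₀ M u₀ v₀ →
      ∀ D : ℝ, 0 < D → ∃ C : ℝ, 0 < C ∧ ∀ dv : ℝ, 0 ≤ dv → dv ≤ D → ∀ k : ℝ, 0 < k →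
        ∀ u v : ℝ → ℝ → ℝ,
          FastReaction.IsSolutionLine F T du dv k (u₀ k) (v₀ k) u v →
          FastReaction.Between Set.univ T M u v →
          FastReaction.ReactionBound Set.univ F T k C u v) ∧
    (∀ u₀ v₀ : ℝ → ℝ → ℝ, FastReaction.IsHalfLineData U₀ V₀ M u₀ v₀ →
      ∀ D : ℝ, 0 < D → ∃ C : ℝ, 0 < C ∧ ∀ dv : ℝ, 0 ≤ dv → dv ≤ D → ∀ k : ℝ, 0 < k →
        ∀ u v : ℝ → ℝ → ℝ,
          FastReaction.IsSolutionHalfLine F T du dv k U₀ (u₀ k) (v₀ k) u v →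
          FastReaction.Between (Set.Ioi 0) T M u v →
          FastReaction.ReactionBound (Set.Ioi 0) F T k C u v) := by
  exact ⟨fun u₀ v₀ hd D hD => FastReaction.exists_reactionBound_line hF hT hdu hU₀ hM hd hD,
    fun u₀ v₀ hd D hD => FastReaction.exists_reactionBound_halfLine hF hT hdu hU₀ hM hd hD⟩
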